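/- Let $k\ge 2$ be an integer, $\Gamma=\mathrm{SL}_2(\mathbb Z)$, $T=\begin{pmatrix}1&1\\0&1\end{pmatrix}$, $q=e^{2\pi i z}$ and $D=\frac1{2\pi i}\frac{d}{dz}$. For an integer $w$ let $M_w^!$ be the space of weakly holomorphic modular forms of weight $w$ for $\Gamma$ (holomorphic on the upper half-plane $\mathfrak H$, modular of weight $w$, with a Fourier expansion $f=\sum_{n\ge -N}a_nq^n$), let $S_w^!$ be its subspace given by $a_0=0$, and let $M_{w,\mathbb Q}^!$, $S_{w,\mathbb Q}^!$ be the $\mathbb Q$-subspaces of forms with rational Fourier coefficients. For $K=\mathbb Q$ or $\mathbb C$ let $P_{k-2}(K)$ be the space of polynomials of degree $\le k-2$ over $K$, with the right $\Gamma$-action $(P\|\gamma)(z)=(cz+d)^{k-2}P(\gamma z)$, $\gamma=\begin{pmatrix}*&*\\c&d\end{pmatrix}$. Put $(d^0v)(\gamma)=v\|\gamma-v$, let $Z^1(\Gamma,P_{k-2}(K))$ be the space of maps $\sigma:\Gamma\to P_{k-2}(K)$ with $\sigma(g_2g_1)=\sigma(g_2)\|g_1+\sigma(g_1)$, let $B^1$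 be the image of $d^0$ on $P_{k-2}(K)$, and let $Z^1_{\mathrm{par}}$, $B^1_{\mathrm{par}}$ be the subspaces of $Z^1$, $B^1$ given by $\sigma(T)=0$. Set $H^1=Z^1/B^1$ and $H^1_{\mathrm{par}}=Z^1_{\mathrm{par}}/B^1_{\mathrm{par}}$. For $f\in M_k^!$ put $$\phi(f)(\gamma)(z)=\int_i^{\gamma^{-1}i}f(w)(w-z)^{k-2}\,dw .$$ For $f=\sum a_nq^n\in S_k^!$ put $\tilde f=\sum_{n>0}a_nq^n$, $\mathring f=\sum_{n<0}a_nq^n$ (a finite sum, hence an entire function) and $$v'_f(z)=\int_z^{i\infty}\tilde f(w)(w-z)^{k-2}\,dw+\int_z^{-i\infty}\mathring f(w)(w-z)^{k-2}\,dw\quad(z\in\mathfrak H),\qquad \phi'(f)=d^0v'_f ,$$ with integration along vertical half-lines. Then $D^{k-1}M_{2-k}^!\subseteq S_k^!$ and $D^{k-1}M_{2-k,\mathbb Q}^!\subseteq S_{k,\mathbb Q}^!$, and the following hold. (a) For $f\in M_k^!$ the map $\phi(f)$ is a cocycle with values in $P_{k-2}(\mathbb C)$, and for $f\in S_k^!$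 the map $\phi'(f)$ is a parabolic cocycle with values in $P_{k-2}(\mathbb C)$. They induce $\mathbb C$-linear maps $[\phi]$, $[\phi']$, and the square $$\begin{array}{ccc} M_k^!/D^{k-1}M_{2-k}^! & \xrightarrow{\ [\phi]\ } & H^1(\Gamma,P_{k-2}(\mathbb C))\\ {\scriptstyle i}\uparrow & & \uparrow{\scriptstyle j}\\ S_k^!/D^{k-1}M_{2-k}^! & \xrightarrow{\ [\phi']\ } & H^1_{\mathrm{par}}(\Gamma,P_{k-2}(\mathbb C))\end{array}$$ in which $i$, $j$ are the natural maps, which are injective, commutes: $j\circ[\phi']=[\phi]\circ i$. (b) The natural maps $H^1(\Gamma,P_{k-2}(\mathbb Q))\otimes_{\mathbb Q}\mathbb C\to H^1(\Gamma,P_{k-2}(\mathbb C))$ and $H^1_{\mathrm{par}}(\Gamma,P_{k-2}(\mathbb Q))\otimes_{\mathbb Q}\mathbb C\to H^1_{\mathrm{par}}(\Gamma,P_{k-2}(\mathbb C))$ are bijective. With these identifications $\phi$ and $\phi'$ induce $\mathbb C$-linear maps $$[\phi]:\bigl(M_{k,\mathbb Q}^!/D^{k-1}M_{2-k,\mathbb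 Q}^!\bigr)\otimes_{\mathbb Q}\mathbb C\to H^1(\Gamma,P_{k-2}(\mathbb Q))\otimes_{\mathbb Q}\mathbb C,\qquad [\phi']:\bigl(S_{k,\mathbb Q}^!/D^{k-1}M_{2-k,\mathbb Q}^!\bigr)\otimes_{\mathbb Q}\mathbb C\to H^1_{\mathrm{par}}(\Gamma,P_{k-2}(\mathbb Q))\otimes_{\mathbb Q}\mathbb C,$$ the natural maps $i\otimes\mathbb C$, $j\otimes\mathbb C$ are injective, and $(j\otimes\mathbb C)\circ[\phi']=[\phi]\circ(i\otimes\mathbb C)$. -/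

import Mathlib

open Complex UpperHalfPlane MeasureTheory
open scoped Manifold MatrixGroups TensorProduct

noncomputable section

/-! ### Weakly holomorphic modular forms for `Γ = SL(2, ℤ)` -/

/-- `e n z = q ^ n` with `q = exp (2 π i z)`. -/
def qPow (n : ℤ) (z : ℂ) : ℂ := Complex.exp (2 * Real.pi * Complex.I * n * z)

/-- The `n`-th Fourier coefficient `∫₀¹ f(x + i) q^{-n} dx` (with `q = exp (2 π i (x + i))`)
of a continuous `1`-periodic function on the upper half-plane. For a function that is the sum of a
Fourier series `∑ aₙ qⁿ`, this is `aₙ`. -/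
def fourierCoef (f : ℍ → ℂ) (n : ℤ) : ℂ :=
  ∫ x in (0 : ℝ)..1, (f ∘ ofComplex) (x + Complex.I) * qPow (-n) (x + Complex.I)

/-- Weakly holomorphic modular forms of weight `w` for `SL(2, ℤ)`: holomorphic on the upper
half-plane, modular of weight `w`, and meromorphic at the cusp, i.e. `f` is the sum of a Fourier
series `∑_{n ≥ -N} aₙ qⁿ` with only finitely many terms of negative index. -/
structure IsWeaklyHolomorphic (w : ℤ) (f : ℍ → ℂ) : Prop where
  mdiff : MDiff f
  modular : ∀ (γ : SL(2, ℤ)) (z : ℍ), f (γ • z) = ((γ 1 0 : ℂ) * z + γ 1 1) ^ w * f z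
  principal : ∃ N : ℕ, ∀ n : ℤ, n < -(N : ℤ) → fourierCoef f n = 0
  hasSum : ∀ z : ℍ, HasSum (fun n : ℤ => fourierCoef f n * qPow n z) (f z)

lemma fourierCoef_intervalIntegrable {f : ℍ → ℂ} (hf : MDiff f) (n : ℤ) :
    IntervalIntegrable
      (fun x : ℝ => (f ∘ ofComplex) (x + Complex.I) * qPow (-n) (x + Complex.I)) volume 0 1 := by
  apply Continuous.intervalIntegrable
  have h1 : ContinuousOn (f ∘ ofComplex) {z | 0 < z.im} :=
    (UpperHalfPlane.mdifferentiable_iff.mp hf).continuousOn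
  have h2 : Continuous fun x : ℝ => (f ∘ ofComplex) (x + Complex.I) :=
    h1.comp_continuous (by fun_prop) (by intro x; simp)
  refine h2.mul ?_
  unfold qPow
  fun_prop

lemma fourierCoef_add {f g : ℍ → ℂ} (hf : MDiff f) (hg : MDiff g) (n : ℤ) :
    fourierCoef (f + g) n = fourierCoef f n + fourierCoef g n := by
  unfold fourierCoef
  rw [← intervalIntegral.integral_add (fourierCoef_intervalIntegrable hf n)
    (fourierCoef_intervalIntegrable hg n)]
  congr 1
  ext x
  simp [add_mul]

lemma fourierCoef_smul (c : ℂ) (f : ℍ → ℂ) (n : ℤ) :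
    fourierCoef (c • f) n = c * fourierCoef f n := by
  unfold fourierCoef
  rw [← intervalIntegral.integral_const_mul]
  congr 1
  ext x
  simp [mul_assoc]

lemma fourierCoef_zero (n : ℤ) : fourierCoef 0 n = 0 := by
  simp [fourierCoef]

lemma IsWeaklyHolomorphic.zero (w : ℤ) : IsWeaklyHolomorphic w 0 where
  mdiff := mdifferentiable_const
  modular := by simp
  principal := ⟨0, fun n _ => fourierCoef_zero n⟩
  hasSum := by intro z; simp [fourierCoef_zero, hasSum_zero]

lemma IsWeaklyHolomorphic.add {w : ℤ} {f g : ℍ → ℂ} (hf : IsWeaklyHolomorphic w f)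
    (hg : IsWeaklyHolomorphic w g) : IsWeaklyHolomorphic w (f + g) where
  mdiff := hf.mdiff.add hg.mdiff
  modular γ z := by
    rw [Pi.add_apply, Pi.add_apply, hf.modular γ z, hg.modular γ z, mul_add]
  principal := by
    obtain ⟨N, hN⟩ := hf.principal
    obtain ⟨M, hM⟩ := hg.principal
    refine ⟨max N M, fun n hn => ?_⟩
    rw [fourierCoef_add hf.mdiff hg.mdiff, hN n (by push_cast at hn; omega),
      hM n (by push_cast at hn; omega), add_zero]
  hasSum z := by
    simpa [fourierCoef_add hf.mdiff hg.mdiff, add_mul] using (hf.hasSum z).add (hg.hasSum z)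

lemma IsWeaklyHolomorphic.smul {w : ℤ} (c : ℂ) {f : ℍ → ℂ} (hf : IsWeaklyHolomorphic w f) :
    IsWeaklyHolomorphic w (c • f) where
  mdiff := hf.mdiff.const_smul c
  modular γ z := by
    rw [Pi.smul_apply, Pi.smul_apply, hf.modular γ z, smul_eq_mul, smul_eq_mul, mul_left_comm]
  principal := by
    obtain ⟨N, hN⟩ := hf.principal
    exact ⟨N, fun n hn => by rw [fourierCoef_smul, hN n hn, mul_zero]⟩
  hasSum z := by
    simpa [fourierCoef_smul, mul_assoc] using (hf.hasSum z).mul_left c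

/-- The `K`-vector space of weakly holomorphic modular forms of weight `w` for `SL(2, ℤ)` all of
whose Fourier coefficients lie in the subfield `K` of `ℂ`. For `K = ℂ` the condition on the
coefficients is empty and this is `M_w^!`; for `K = ℚ` it is `M_{w,ℚ}^!`. -/
def weakForms (K : Type) [Field K] [Algebra K ℂ] (w : ℤ) : Submodule K (ℍ → ℂ) where
  carrier := {f | IsWeaklyHolomorphic w f ∧ ∀ n, fourierCoef f n ∈ Set.range (algebraMap K ℂ)}
  zero_mem' := ⟨.zero w, fun n => ⟨0, by simp [fourierCoef_zero]⟩⟩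
  add_mem' := by
    rintro f g ⟨hf, hf'⟩ ⟨hg, hg'⟩
    refine ⟨hf.add hg, fun n => ?_⟩
    obtain ⟨a, ha⟩ := hf' n
    obtain ⟨b, hb⟩ := hg' n
    exact ⟨a + b, by rw [fourierCoef_add hf.mdiff hg.mdiff, map_add, ha, hb]⟩
  smul_mem' := by
    rintro c f ⟨hf, hf'⟩
    rw [← algebraMap_smul ℂ c f]
    refine ⟨hf.smul _, fun n => ?_⟩
    obtain ⟨a, ha⟩ := hf' n
    exact ⟨c * a, by rw [fourierCoef_smul, map_mul, ha]⟩

/-- The subspace of weakly holomorphic cusp forms: the constant term of the Fourier expansion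
vanishes (`S_w^!` for `K = ℂ`, and `S_{w,ℚ}^!` for `K = ℚ`). -/
def weakCuspForms (K : Type) [Field K] [Algebra K ℂ] (w : ℤ) : Submodule K (ℍ → ℂ) where
  carrier := {f | f ∈ weakForms K w ∧ fourierCoef f 0 = 0}
  zero_mem' := ⟨zero_mem _, fourierCoef_zero 0⟩
  add_mem' := by
    rintro f g ⟨hf, hf'⟩ ⟨hg, hg'⟩
    exact ⟨add_mem hf hg, by rw [fourierCoef_add hf.1.mdiff hg.1.mdiff, hf', hg', add_zero]⟩
  smul_mem' := by
    rintro c f ⟨hf, hf'⟩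
    refine ⟨Submodule.smul_mem _ c hf, ?_⟩
    rw [← algebraMap_smul ℂ c f, fourierCoef_smul, hf', mul_zero]

lemma weakCuspForms_le (K : Type) [Field K] [Algebra K ℂ] (w : ℤ) :
    weakCuspForms K w ≤ weakForms K w := fun _ hf => hf.1

/-- The iterate `D ^ n` of `D = (2 π i)⁻¹ d/dz`. -/
def iterD (n : ℕ) (f : ℍ → ℂ) : ℍ → ℂ := Derivative.normalizedDerivOfComplex^[n] f

lemma iterD_mdiff (n : ℕ) {f : ℍ → ℂ} (hf : MDiff f) : MDiff (iterD n f) := by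
  induction n with
  | zero => exact hf
  | succ n ih =>
    unfold iterD at *
    rw [Function.iterate_succ_apply']
    exact Derivative.normalizedDerivOfComplex_mdifferentiable ih

lemma iterD_add (n : ℕ) {f g : ℍ → ℂ} (hf : MDiff f) (hg : MDiff g) :
    iterD n (f + g) = iterD n f + iterD n g := by
  induction n with
  | zero => rfl
  | succ n ih =>
    have h1 := iterD_mdiff n hf
    have h2 := iterD_mdiff n hg
    unfold iterD at *
    rw [Function.iterate_succ_apply', ih, Derivative.normalizedDerivOfComplex_add _ _ h1 h2,
      Function.iterate_succ_apply', Function.iterate_succ_apply']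

lemma iterD_smul (n : ℕ) (c : ℂ) {f : ℍ → ℂ} (hf : MDiff f) :
    iterD n (c • f) = c • iterD n f := by
  induction n with
  | zero => rfl
  | succ n ih =>
    have h1 := iterD_mdiff n hf
    unfold iterD at *
    rw [Function.iterate_succ_apply', ih, Derivative.normalizedDerivOfComplex_smul _ _ h1,
      Function.iterate_succ_apply']

/-- The space `D^{k-1} M_{2-k}^!` (for `K = ℂ`), resp. `D^{k-1} M_{2-k,ℚ}^!` (for `K = ℚ`). -/
def exactForms (K : Type) [Field K] [Algebra K ℂ] (k : ℕ) : Submodule K (ℍ → ℂ) where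
  carrier := {f | ∃ g ∈ weakForms K (2 - k), f = iterD (k - 1) g}
  zero_mem' := ⟨0, zero_mem _, by
    have := iterD_smul (k - 1) 0 (f := 0) mdifferentiable_const
    simpa using this.symm⟩
  add_mem' := by
    rintro _ _ ⟨f, hf, rfl⟩ ⟨g, hg, rfl⟩
    exact ⟨f + g, add_mem hf hg, (iterD_add _ hf.1.mdiff hg.1.mdiff).symm⟩
  smul_mem' := by
    rintro c _ ⟨f, hf, rfl⟩
    refine ⟨c • f, Submodule.smul_mem _ c hf, ?_⟩
    rw [← algebraMap_smul ℂ c f, iterD_smul _ _ hf.1.mdiff, algebraMap_smul]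

/-- `M_k^! / D^{k-1} M_{2-k}^!`, with Fourier coefficients in `K`. -/
abbrev FormClasses (K : Type) [Field K] [Algebra K ℂ] (k : ℕ) : Type :=
  weakForms K k ⧸ (exactForms K k).submoduleOf (weakForms K k)

/-- `S_k^! / D^{k-1} M_{2-k}^!`, with Fourier coefficients in `K`. -/
abbrev CuspFormClasses (K : Type) [Field K] [Algebra K ℂ] (k : ℕ) : Type :=
  weakCuspForms K k ⧸ (exactForms K k).submoduleOf (weakCuspForms K k)

/-- The class of a form `f` in `M_k^! / D^{k-1} M_{2-k}^!`. -/
def formClass (K : Type) [Field K] [Algebra K ℂ] (k : ℕ) (f : weakForms K k) : FormClasses K k :=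
  Submodule.Quotient.mk f

/-- The class of a cusp form `f` in `S_k^! / D^{k-1} M_{2-k}^!`. -/
def cuspFormClass (K : Type) [Field K] [Algebra K ℂ] (k : ℕ) (f : weakCuspForms K k) :
    CuspFormClasses K k :=
  Submodule.Quotient.mk f

/-- The natural map `i : S_k^! / D^{k-1} M_{2-k}^! → M_k^! / D^{k-1} M_{2-k}^!`, `[f] ↦ [f]`. -/
def natI (K : Type) [Field K] [Algebra K ℂ] (k : ℕ) :
    CuspFormClasses K k →ₗ[K] FormClasses K k :=
  Submodule.mapQ _ _ (Submodule.inclusion (weakCuspForms_le K k)) (fun _ hf => hf)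

/-! ### Eichler cohomology and parabolic cohomology -/

/-- `P_m(K)`: polynomials of degree at most `m` with coefficients in `K`. -/
def PolyLE (K : Type) [Field K] (m : ℕ) : Type := Polynomial.degreeLE K (m : WithBot ℕ)

instance (K : Type) [Field K] (m : ℕ) : AddCommGroup (PolyLE K m) :=
  inferInstanceAs (AddCommGroup (Polynomial.degreeLE K (m : WithBot ℕ)))

instance (R K : Type) [CommSemiring R] [Field K] [Algebra R K] (m : ℕ) : Module R (PolyLE K m) :=
  inferInstanceAs (Module R (Polynomial.degreeLE K (m : WithBot ℕ)))

instance (R K : Type) [CommSemiring R] [Field K] [Algebra R K] (m : ℕ) :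
    IsScalarTower R K (PolyLE K m) :=
  inferInstanceAs (IsScalarTower R K (Polynomial.degreeLE K (m : WithBot ℕ)))

/-- The polynomial underlying an element of `P_m(K)`, as a linear map. -/
def PolyLE.toPoly {K : Type} [Field K] {m : ℕ} : PolyLE K m →ₗ[K] Polynomial K :=
  (Polynomial.degreeLE K (m : WithBot ℕ)).subtype

lemma PolyLE.degree_le {K : Type} [Field K] {m : ℕ} (p : PolyLE K m) :
    p.toPoly.degree ≤ m := Polynomial.mem_degreeLE.mp p.2

lemma PolyLE.toPoly_injective {K : Type} [Field K] {m : ℕ} :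
    Function.Injective (PolyLE.toPoly (K := K) (m := m)) := Subtype.val_injective

lemma PolyLE.toPoly_smul {R K : Type} [CommSemiring R] [Field K] [Algebra R K] {m : ℕ} (c : R)
    (p : PolyLE K m) : (c • p).toPoly = c • p.toPoly := rfl

/-- A polynomial of degree at most `m`, as an element of `P_m(K)`. -/
def PolyLE.ofPoly {K : Type} [Field K] {m : ℕ} (p : Polynomial K) (hp : p.degree ≤ m) :
    PolyLE K m := ⟨p, Polynomial.mem_degreeLE.mpr hp⟩

lemma PolyLE.toPoly_ofPoly {K : Type} [Field K] {m : ℕ} (p : Polynomial K)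
    (hp : p.degree ≤ m) : (PolyLE.ofPoly p hp).toPoly = p := rfl

open Polynomial in
/-- The polynomial `(c X + d)^m p((a X + b) / (c X + d))`, for `p` of degree at most `m`. -/
def slashRaw {K : Type} [Field K] (m : ℕ) (γ : SL(2, ℤ)) (p : K[X]) : K[X] :=
  ∑ i ∈ Finset.range (m + 1), C (p.coeff i) *
    ((C (γ 0 0 : K) * X + C (γ 0 1 : K)) ^ i * (C (γ 1 0 : K) * X + C (γ 1 1 : K)) ^ (m - i))

open Polynomial in
lemma slashRaw_degree_le {K : Type} [Field K] (m : ℕ) (γ : SL(2, ℤ)) (p : K[X]) :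
    (slashRaw m γ p).degree ≤ m := by
  refine degree_le_of_natDegree_le (natDegree_sum_le_of_forall_le _ _ fun i hi => ?_)
  have hi' : i ≤ m := by simpa [Nat.lt_succ_iff] using hi
  have hl : ∀ a b : K, (C a * X + C b).natDegree ≤ 1 := fun a b => natDegree_linear_le
  refine (natDegree_C_mul_le _ _).trans (natDegree_mul_le.trans ?_)
  have h1 := natDegree_pow_le_of_le (p := C (γ 0 0 : K) * X + C (γ 0 1 : K)) i (hl _ _)
  have h2 := natDegree_pow_le_of_le (p := C (γ 1 0 : K) * X + C (γ 1 1 : K)) (m - i) (hl _ _)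
  omega

open Polynomial in
/-- The right action of weights `(-m, 0)` of `SL(2, ℤ)` on `P_m(K)`:
`(P ∥ γ)(z) = (c z + d)^m P((a z + b) / (c z + d))`. -/
def polySlash (K : Type) [Field K] (m : ℕ) (γ : SL(2, ℤ)) : PolyLE K m →ₗ[K] PolyLE K m where
  toFun p := .ofPoly (slashRaw m γ p.toPoly) (slashRaw_degree_le m γ p.toPoly)
  map_add' p q := by
    apply PolyLE.toPoly_injective
    simp [PolyLE.toPoly_ofPoly, slashRaw, add_mul, Finset.sum_add_distrib]
  map_smul' c p := by
    apply PolyLE.toPoly_injective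
    simp [PolyLE.toPoly_ofPoly, slashRaw, Finset.smul_sum, smul_eq_C_mul, mul_assoc]

open Polynomial in
lemma polySlash_toPoly {K : Type} [Field K] (m : ℕ) (γ : SL(2, ℤ)) (p : PolyLE K m) :
    (polySlash K m γ p).toPoly = slashRaw m γ p.toPoly := rfl

open Polynomial in
lemma polySlash_eval {K : Type} [Field K] (m : ℕ) (γ : SL(2, ℤ)) (p : PolyLE K m) (z : K)
    (hz : (γ 1 0 : K) * z + γ 1 1 ≠ 0) :
    (polySlash K m γ p).toPoly.eval z = ((γ 1 0 : K) * z + γ 1 1) ^ m *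
      p.toPoly.eval (((γ 0 0 : K) * z + γ 0 1) / ((γ 1 0 : K) * z + γ 1 1)) := by
  have hp : p.toPoly.natDegree < m + 1 :=
    Nat.lt_succ_of_le (natDegree_le_of_degree_le p.degree_le)
  rw [eval_eq_sum_range' hp, Finset.mul_sum]
  simp only [polySlash_toPoly, slashRaw, eval_finsetSum]
  refine Finset.sum_congr rfl fun i hi => ?_
  have hi' : i ≤ m := by simpa [Nat.lt_succ_iff] using hi
  simp only [eval_mul, eval_C, eval_pow, eval_add, eval_X, div_pow]
  rw [pow_sub₀ _ hz hi']
  field_simp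

/-- The differential `d⁰ : C⁰(Γ, P_m(K)) → C¹(Γ, P_m(K))`, `(d⁰ P)(γ) = P ∥ γ - P`. -/
def dZero (K : Type) [Field K] (m : ℕ) : PolyLE K m →ₗ[K] (SL(2, ℤ) → PolyLE K m) :=
  LinearMap.pi fun γ => polySlash K m γ - LinearMap.id

/-- The differential `d¹ : C¹(Γ, P_m(K)) → C²(Γ, P_m(K))`,
`(d¹ σ)(g₁, g₂) = σ(g₂) ∥ g₁ - σ(g₂ g₁) + σ(g₁)`. -/
def dOne (K : Type) [Field K] (m : ℕ) :
    (SL(2, ℤ) → PolyLE K m) →ₗ[K] (SL(2, ℤ) × SL(2, ℤ) → PolyLE K m) :=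
  LinearMap.pi fun g =>
    polySlash K m g.1 ∘ₗ (LinearMap.proj g.2 : (SL(2, ℤ) → PolyLE K m) →ₗ[K] PolyLE K m)
      - LinearMap.proj (g.2 * g.1) + LinearMap.proj g.1

/-- `1`-cocycles `Z¹(Γ, P_m(K))`. -/
def cocycles (K : Type) [Field K] (m : ℕ) : Submodule K (SL(2, ℤ) → PolyLE K m) :=
  LinearMap.ker (dOne K m)

/-- `1`-coboundaries `B¹(Γ, P_m(K))`. -/
def coboundaries (K : Type) [Field K] (m : ℕ) : Submodule K (SL(2, ℤ) → PolyLE K m) :=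
  LinearMap.range (dZero K m)

/-- The cochains `ψ` with `ψ(T) = 0`, where `T = (1 1; 0 1)`. -/
def vanishAtT (K : Type) [Field K] (m : ℕ) : Submodule K (SL(2, ℤ) → PolyLE K m) :=
  LinearMap.ker (LinearMap.proj (R := K) (φ := fun _ : SL(2, ℤ) => PolyLE K m) ModularGroup.T)

/-- Parabolic cocycles `Z¹_par(Γ, P_m(K))`. -/
def parCocycles (K : Type) [Field K] (m : ℕ) : Submodule K (SL(2, ℤ) → PolyLE K m) :=
  cocycles K m ⊓ vanishAtT K m

/-- Parabolic coboundaries `B¹_par(Γ, P_m(K))`. -/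
def parCoboundaries (K : Type) [Field K] (m : ℕ) : Submodule K (SL(2, ℤ) → PolyLE K m) :=
  coboundaries K m ⊓ vanishAtT K m

/-- `H¹(Γ, P_m(K)) = Z¹ / B¹`. -/
abbrev HOne (K : Type) [Field K] (m : ℕ) : Type :=
  cocycles K m ⧸ (coboundaries K m).submoduleOf (cocycles K m)

/-- `H¹_par(Γ, P_m(K)) = Z¹_par / B¹_par`. -/
abbrev HOnePar (K : Type) [Field K] (m : ℕ) : Type :=
  parCocycles K m ⧸ (parCoboundaries K m).submoduleOf (parCocycles K m)

/-- The class in `H¹` of a cocycle. -/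
def cocycleClass (K : Type) [Field K] (m : ℕ) (σ : cocycles K m) : HOne K m :=
  Submodule.Quotient.mk σ

/-- The class in `H¹_par` of a parabolic cocycle. -/
def parCocycleClass (K : Type) [Field K] (m : ℕ) (σ : parCocycles K m) : HOnePar K m :=
  Submodule.Quotient.mk σ

lemma parCocycles_le (K : Type) [Field K] (m : ℕ) : parCocycles K m ≤ cocycles K m := inf_le_left

/-- The natural map `j : H¹_par(Γ, P_m(K)) → H¹(Γ, P_m(K))`, `[σ] ↦ [σ]`. -/
def natJ (K : Type) [Field K] (m : ℕ) : HOnePar K m →ₗ[K] HOne K m :=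
  Submodule.mapQ _ _ (Submodule.inclusion (parCocycles_le K m)) (fun _ hσ => hσ.1)

/-! ### Extension of scalars in cohomology -/

section BaseChange

variable (K : Type) [Field K] [Algebra K ℂ] (m : ℕ)

/-- The map `P_m(K) → P_m(ℂ)` induced by `K → ℂ`. -/
def polyExt : PolyLE K m →ₗ[K] PolyLE ℂ m where
  toFun p := .ofPoly (p.toPoly.map (algebraMap K ℂ)) (Polynomial.degree_map_le.trans p.degree_le)
  map_add' p q := by
    apply PolyLE.toPoly_injective
    simp [PolyLE.toPoly_ofPoly]
  map_smul' c p := by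
    apply PolyLE.toPoly_injective
    simp [PolyLE.toPoly_ofPoly, Polynomial.map_smul, algebraMap_smul]

lemma polyExt_toPoly (p : PolyLE K m) :
    (polyExt K m p).toPoly = p.toPoly.map (algebraMap K ℂ) := rfl

open Polynomial in
lemma polyExt_slash (γ : SL(2, ℤ)) (p : PolyLE K m) :
    polyExt K m (polySlash K m γ p) = polySlash ℂ m γ (polyExt K m p) := by
  apply PolyLE.toPoly_injective
  rw [polyExt_toPoly, polySlash_toPoly, polySlash_toPoly, polyExt_toPoly]
  simp only [slashRaw, Polynomial.map_sum, Polynomial.map_mul, Polynomial.map_pow,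
    Polynomial.map_add, map_C, map_X, coeff_map, map_intCast, Polynomial.map_intCast]

/-- The map on cochains `C¹(Γ, P_m(K)) → C¹(Γ, P_m(ℂ))` induced by `K → ℂ`. -/
def cochainExt : (SL(2, ℤ) → PolyLE K m) →ₗ[K] (SL(2, ℤ) → PolyLE ℂ m) :=
  LinearMap.pi fun γ => polyExt K m ∘ₗ LinearMap.proj γ

lemma cochainExt_cocycles {σ : SL(2, ℤ) → PolyLE K m} (hσ : σ ∈ cocycles K m) :
    cochainExt K m σ ∈ (cocycles ℂ m).restrictScalars K := by
  simp only [cocycles, LinearMap.mem_ker, Submodule.restrictScalars_mem] at hσ ⊢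
  ext1 g
  have h := congrArg (polyExt K m) (congrFun hσ g)
  simpa [dOne, cochainExt, polyExt_slash] using h

lemma cochainExt_coboundaries {σ : SL(2, ℤ) → PolyLE K m} (hσ : σ ∈ coboundaries K m) :
    cochainExt K m σ ∈ (coboundaries ℂ m).restrictScalars K := by
  obtain ⟨p, rfl⟩ := hσ
  refine ⟨polyExt K m p, ?_⟩
  ext1 g
  simp [dZero, cochainExt, polyExt_slash]

lemma cochainExt_vanishAtT {σ : SL(2, ℤ) → PolyLE K m} (hσ : σ ∈ vanishAtT K m) :
    cochainExt K m σ ∈ (vanishAtT ℂ m).restrictScalars K := by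
  simp only [vanishAtT, LinearMap.mem_ker, Submodule.restrictScalars_mem,
    LinearMap.proj_apply] at hσ ⊢
  simp [cochainExt, hσ]

/-- Extension of scalars on cocycles. -/
def cocycleExt : cocycles K m →ₗ[K] cocycles ℂ m where
  toFun σ := ⟨cochainExt K m σ.1, cochainExt_cocycles K m σ.2⟩
  map_add' σ τ := by ext1; simp
  map_smul' c σ := by ext1; simp

/-- Extension of scalars on parabolic cocycles. -/
def parCocycleExt : parCocycles K m →ₗ[K] parCocycles ℂ m where
  toFun σ := ⟨cochainExt K m σ.1,
    cochainExt_cocycles K m σ.2.1, cochainExt_vanishAtT K m σ.2.2⟩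
  map_add' σ τ := by ext1; simp
  map_smul' c σ := by ext1; simp

/-- The natural `ℂ`-linear map `ℂ ⊗ H¹(Γ, P_m(K)) → H¹(Γ, P_m(ℂ))`, `a ⊗ [σ] ↦ a [σ]`. -/
def compareH : ℂ ⊗[K] HOne K m →ₗ[ℂ] HOne ℂ m :=
  LinearMap.liftBaseChange ℂ <|
    Submodule.liftQ _
      (((Submodule.mkQ ((coboundaries ℂ m).submoduleOf (cocycles ℂ m))).restrictScalars K) ∘ₗ
        cocycleExt K m)
      (fun _ hσ => (Submodule.Quotient.mk_eq_zero _).mpr (cochainExt_coboundaries K m hσ))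

/-- The natural `ℂ`-linear map `ℂ ⊗ H¹_par(Γ, P_m(K)) → H¹_par(Γ, P_m(ℂ))`, `a ⊗ [σ] ↦ a [σ]`. -/
def compareHPar : ℂ ⊗[K] HOnePar K m →ₗ[ℂ] HOnePar ℂ m :=
  LinearMap.liftBaseChange ℂ <|
    Submodule.liftQ _
      (((Submodule.mkQ ((parCoboundaries ℂ m).submoduleOf
        (parCocycles ℂ m))).restrictScalars K) ∘ₗ parCocycleExt K m)
      (fun _ hσ => (Submodule.Quotient.mk_eq_zero _).mpr
        ⟨cochainExt_coboundaries K m hσ.1, cochainExt_vanishAtT K m hσ.2⟩)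

end BaseChange

/-! ### The two cocycles attached to a form -/

/-- `φ(f)(γ)(z) = ∫_i^{γ⁻¹ i} f(w) (w - z)^{k-2} dw`, integrated along the line segment from `i`
to `γ⁻¹ i` in the upper half-plane. -/
def eichlerIntegral (k : ℕ) (f : ℍ → ℂ) (γ : SL(2, ℤ)) (z : ℂ) : ℂ :=
  ∫ t in (0 : ℝ)..1,
    (f ∘ ofComplex) (AffineMap.lineMap Complex.I ((γ⁻¹ • UpperHalfPlane.I : ℍ) : ℂ) t) *
      (AffineMap.lineMap Complex.I ((γ⁻¹ • UpperHalfPlane.I : ℍ) : ℂ) t - z) ^ (k - 2) *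
      (((γ⁻¹ • UpperHalfPlane.I : ℍ) : ℂ) - Complex.I)

/-- The exponentially decaying part `f̃ = ∑_{n > 0} aₙ qⁿ`. -/
def decayingPart (f : ℍ → ℂ) (z : ℂ) : ℂ :=
  ∑' n : ℤ, if 0 < n then fourierCoef f n * qPow n z else 0

/-- The principal part `f̊ = ∑_{n < 0} aₙ qⁿ`: for a weakly holomorphic form this is a finite sum,
hence an entire function. -/
def principalPart (f : ℍ → ℂ) (z : ℂ) : ℂ :=
  ∑' n : ℤ, if n < 0 then fourierCoef f n * qPow n z else 0

/-- `∫_z^{i∞} g(w) (w - z)^{k-2} dw`, along the vertical half-line `w = z + i t`, `t > 0`. -/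
def integralUp (k : ℕ) (g : ℂ → ℂ) (z : ℂ) : ℂ :=
  ∫ t in Set.Ioi (0 : ℝ),
    g (z + Complex.I * t) * ((z + Complex.I * t) - z) ^ (k - 2) * Complex.I

/-- `∫_z^{-i∞} g(w) (w - z)^{k-2} dw`, along the vertical half-line `w = z - i t`, `t > 0`. -/
def integralDown (k : ℕ) (g : ℂ → ℂ) (z : ℂ) : ℂ :=
  ∫ t in Set.Ioi (0 : ℝ),
    g (z - Complex.I * t) * ((z - Complex.I * t) - z) ^ (k - 2) * (-Complex.I)

/-- `v'_f(z) = ∫_z^{i∞} f̃(w) (w - z)^{k-2} dw + ∫_z^{-i∞} f̊(w) (w - z)^{k-2} dw`. -/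
def vPrime (k : ℕ) (f : ℍ → ℂ) (z : ℍ) : ℂ :=
  integralUp k (decayingPart f) z + integralDown k (principalPart f) z

/-- The coboundary `(d⁰ v)(γ) = v ∥ γ - v` of a function `v` on the upper half-plane for the action
of weights `(-m, 0)`, `(v ∥ γ)(z) = (c z + d)^m v(γ z)`. -/
def dZeroFun (m : ℕ) (v : ℍ → ℂ) (γ : SL(2, ℤ)) (z : ℍ) : ℂ :=
  ((γ 1 0 : ℂ) * z + γ 1 1) ^ m * v (γ • z) - v z

/-- The polynomial valued cochain `σ` is `φ(f)`. -/
def IsEichlerCocycle (k : ℕ) (f : ℍ → ℂ) (σ : SL(2, ℤ) → PolyLE ℂ (k - 2)) : Prop :=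
  ∀ (γ : SL(2, ℤ)) (z : ℂ), (σ γ).toPoly.eval z = eichlerIntegral k f γ z

/-- The polynomial valued cochain `σ` is `φ'(f) = d⁰ v'_f`. -/
def IsCuspCocycle (k : ℕ) (f : ℍ → ℂ) (σ : SL(2, ℤ) → PolyLE ℂ (k - 2)) : Prop :=
  ∀ (γ : SL(2, ℤ)) (z : ℍ), (σ γ).toPoly.eval (z : ℂ) = dZeroFun (k - 2) (vPrime k f) γ z

end

/-! Write `m = k - 2` and let `F_r` be the `r`-fold primitive of `f = ∑ aₙ qⁿ`, obtained by dividing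
`aₙ` by `(2πin)^r` for `n ≠ 0` and adding `a₀ z^r / r!`. Repeated integration by parts gives an
explicit primitive `K(w, z)` of `f(w)(w - z)^m dw` (`eichlerKernel`). It is a polynomial of degree
at most `m` in `z`, and its diagonal is `K(z, z) = (-1)^m m! F_{m+1}(z)`.

Three facts about `K` give part (a). First, `φ(f)(γ) = K(γ⁻¹i, ·) - K(i, ·)`, so the values are
polynomials. Second, by modularity of `f`, `(cz+d)^m K(γp, γz) - K(p, z)` does not depend on `p`
(`eichlerKernel_smul_smul`). Comparing `p = γ⁻¹i` with `p = z` shows that `φ(f)` is the coboundary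
of the function `K(i, z) - K(z, z)`, hence a cocycle. Third, if `a₀ = 0`, termwise integration gives
`v'_f(z) = -K(z, z)` (`vPrime_eq`), so `φ'(f) = φ(f) - d⁰K(i, ·)`. As `K(i, ·)` is a polynomial,
`φ(f)` and `φ'(f)` have the same class, and `φ'(f)(T) = 0` because `v'_f` is a series in `q`.

If `f = D^{k-1} g` with `g` of weight `2 - k`, then `K(z, z)` is a multiple of `g - b₀`, where `b₀`
is the constant term of `g`. The function `g` is invariant under the action of weight `-m`, so only
the polynomial `K(i, ·)` plus a constant contributes and `φ(f)` is a coboundary. That `D^{k-1} g` is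
modular of weight `k` is Bol's identity (`iterD_slash`).

For part (b), the action on polynomials has integral matrix entries, so taking coordinates with
respect to a `K`-basis of `ℂ` preserves cocycles, coboundaries and vanishing at `T`. As `S` and `T`
generate the group, only finitely many basis vectors occur in a given cocycle
(`bijective_of_coord`). The rational statements are then transported from part (a), and injectivity
survives the tensor product by flatness. -/

noncomputable section

/-! ### Series in `q` -/

lemma norm_qPow (n : ℤ) (z : ℂ) : ‖qPow n z‖ = Real.exp (-(2 * Real.pi * n * z.im)) := by
  rw [qPow, Complex.norm_exp]
  congr 1
  simp [Complex.mul_re, Complex.mul_im]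

lemma qPow_add (m n : ℤ) (z : ℂ) : qPow (m + n) z = qPow m z * qPow n z := by
  rw [qPow, qPow, qPow, ← Complex.exp_add]
  push_cast
  ring_nf

lemma qPow_add_arg (n : ℤ) (z w : ℂ) : qPow n (z + w) = qPow n z * qPow n w := by
  rw [qPow, qPow, qPow, ← Complex.exp_add]
  ring_nf

lemma qPow_zero (z : ℂ) : qPow 0 z = 1 := by simp [qPow]

lemma qPow_one_arg (n : ℤ) : qPow n 1 = 1 := by
  rw [qPow, Complex.exp_eq_one_iff]
  exact ⟨n, by ring⟩

lemma hasDerivAt_qPow (n : ℤ) (z : ℂ) :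
    HasDerivAt (qPow n) (2 * Real.pi * Complex.I * n * qPow n z) z := by
  have h : HasDerivAt (fun z : ℂ => 2 * Real.pi * Complex.I * n * z)
      (2 * Real.pi * Complex.I * n) z := by
    simpa using (hasDerivAt_id z).const_mul (2 * Real.pi * Complex.I * (n : ℂ))
  have h' := h.cexp
  rwa [mul_comm (Complex.exp _)] at h'

lemma continuous_qPow (n : ℤ) : Continuous (qPow n) := by
  unfold qPow
  fun_prop

/-- The series `∑ aₙ qⁿ` converges (absolutely) on the upper half-plane. -/
def QSummable (a : ℤ → ℂ) : Prop := ∀ z : ℍ, Summable fun n => a n * qPow n z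

/-- The sum of the series `∑ aₙ qⁿ`. -/
def qSeries (a : ℤ → ℂ) (z : ℂ) : ℂ := ∑' n, a n * qPow n z

lemma QSummable.of_norm_le {a b : ℤ → ℂ} (ha : QSummable a) (h : ∀ n, ‖b n‖ ≤ ‖a n‖) :
    QSummable b := fun z => by
  refine Summable.of_norm_bounded (ha z).norm fun n => ?_
  rw [norm_mul, norm_mul]
  exact mul_le_mul_of_nonneg_right (h n) (norm_nonneg _)

lemma QSummable.hasSum {a : ℤ → ℂ} (ha : QSummable a) {z : ℂ} (hz : 0 < z.im) :
    HasSum (fun n => a n * qPow n z) (qSeries a z) := (ha ⟨z, hz⟩).hasSum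

/-- Termwise differentiation on the strip between heights `Im z / 2` and `2 Im z`. There `|qⁿ|` is
largest on the lower edge for `n ≥ 0` and on the upper edge for `n < 0`, so the sum of the two edge
values dominates every term of the two-sided series. -/
lemma QSummable.hasSum_deriv {a : ℤ → ℂ} (ha : QSummable a) {z : ℂ} (hz : 0 < z.im) :
    HasSum (fun n : ℤ => 2 * Real.pi * Complex.I * n * a n * qPow n z) (deriv (qSeries a) z) ∧
      DifferentiableAt ℂ (qSeries a) z := by
  set U : Set ℂ := {w | z.im / 2 < w.im} ∩ {w | w.im < 2 * z.im} with hU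
  have hUo : IsOpen U :=
    (isOpen_lt continuous_const Complex.continuous_im).inter
      (isOpen_lt Complex.continuous_im continuous_const)
  have hzU : z ∈ U := ⟨by simp only [Set.mem_ofPred_eq]; linarith,
    by simp only [Set.mem_ofPred_eq]; linarith⟩
  have hy1 : 0 < (z.im / 2 * Complex.I).im := by simp; linarith
  have hy2 : 0 < ((2 * z.im : ℝ) * Complex.I).im := by simp [hz]
  have hu := ((ha ⟨_, hy1⟩).norm.add (ha ⟨_, hy2⟩).norm)
  have hd : ∀ n : ℤ, DifferentiableOn ℂ (fun w => a n * qPow n w) U := fun n w _ =>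
    ((hasDerivAt_qPow n w).const_mul (a n)).differentiableAt.differentiableWithinAt
  have hle : ∀ (n : ℤ) (w : ℂ), w ∈ U → ‖a n * qPow n w‖ ≤
      ‖a n * qPow n ((⟨_, hy1⟩ : ℍ) : ℂ)‖ + ‖a n * qPow n ((⟨_, hy2⟩ : ℍ) : ℂ)‖ := by
    intro n w hw
    simp only [norm_mul, ← mul_add]
    refine mul_le_mul_of_nonneg_left ?_ (norm_nonneg _)
    rw [norm_qPow, norm_qPow, norm_qPow]
    have h1 : z.im / 2 < w.im := hw.1
    have h2 : w.im < 2 * z.im := hw.2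
    have e1 : ((⟨_, hy1⟩ : ℍ) : ℂ).im = z.im / 2 := by simp
    have e2 : ((⟨_, hy2⟩ : ℍ) : ℂ).im = 2 * z.im := by simp
    rw [e1, e2]
    have hpi := Real.pi_pos
    rcases le_or_gt 0 n with hn | hn
    · have hn' : (0 : ℝ) ≤ n := by exact_mod_cast hn
      refine le_add_of_le_of_nonneg (Real.exp_le_exp.mpr ?_) (Real.exp_pos _).le
      have : 0 ≤ 2 * Real.pi * n := by positivity
      nlinarith
    · have hn' : (0 : ℝ) ≤ -(n : ℝ) := by
        have : (n : ℝ) < 0 := by exact_mod_cast hn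
        linarith
      refine le_add_of_nonneg_of_le (Real.exp_pos _).le (Real.exp_le_exp.mpr ?_)
      have : 0 ≤ 2 * Real.pi * -(n : ℝ) := by positivity
      nlinarith
  constructor
  · have h := Complex.hasSum_deriv_of_summable_norm hu hd hUo hle hzU
    convert! h using 2 with n
    rw [((hasDerivAt_qPow n z).const_mul (a n)).deriv]
    ring
  · exact (Complex.differentiableOn_tsum_of_summable_norm hu hd hUo hle).differentiableAt
      (hUo.mem_nhds hzU)

lemma QSummable.hasDerivAt {a : ℤ → ℂ} (ha : QSummable a) {z : ℂ} (hz : 0 < z.im) :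
    HasDerivAt (qSeries a) (qSeries (fun n : ℤ => 2 * Real.pi * Complex.I * n * a n) z) z := by
  have h := ha.hasSum_deriv hz
  rw [qSeries, h.1.tsum_eq]
  exact h.2.hasDerivAt

lemma QSummable.normalizedDeriv {a : ℤ → ℂ} {f : ℍ → ℂ}
    (hf : ∀ z : ℍ, HasSum (fun n => a n * qPow n z) (f z)) (z : ℍ) :
    HasSum (fun n : ℤ => n * a n * qPow n z) (Derivative.normalizedDerivOfComplex f z) := by
  have ha : QSummable a := fun z => (hf z).summable
  have he : f ∘ ofComplex =ᶠ[nhds (z : ℂ)] qSeries a := by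
    filter_upwards [UpperHalfPlane.isOpen_upperHalfPlaneSet.mem_nhds z.im_pos] with w hw
    rw [Function.comp_apply, ofComplex_apply_of_im_pos hw, qSeries, (hf ⟨w, hw⟩).tsum_eq]
  rw [Derivative.normalizedDerivOfComplex, he.deriv_eq]
  refine ((ha.hasSum_deriv z.im_pos).1.mul_left ((2 * Real.pi * Complex.I)⁻¹)).congr_fun ?_
  intro n
  have := Complex.two_pi_I_ne_zero
  field_simp

lemma hasSum_iterD {a : ℤ → ℂ} {f : ℍ → ℂ}
    (hf : ∀ z : ℍ, HasSum (fun n => a n * qPow n z) (f z)) (j : ℕ) (z : ℍ) :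
    HasSum (fun n : ℤ => (n : ℂ) ^ j * a n * qPow n z) (iterD j f z) := by
  induction j generalizing z with
  | zero => simpa [iterD] using hf z
  | succ j ih =>
    have h := QSummable.normalizedDeriv ih z
    have e : iterD (j + 1) f z = Derivative.normalizedDerivOfComplex (iterD j f) z :=
      congrFun (Function.iterate_succ_apply' _ _ _) z
    rw [e]
    simpa only [pow_succ', mul_assoc] using h

lemma integral_qPow (n : ℤ) :
    ∫ x in (0 : ℝ)..1, qPow n (x + Complex.I) = if n = 0 then 1 else 0 := by
  split_ifs with hn
  · simp [hn, qPow_zero]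
  · have hc : 2 * Real.pi * Complex.I * n ≠ 0 :=
      mul_ne_zero Complex.two_pi_I_ne_zero (by exact_mod_cast hn)
    have h1 : Complex.exp (2 * Real.pi * Complex.I * n) = 1 := by
      simpa [qPow] using qPow_one_arg n
    simp_rw [qPow_add_arg n _ Complex.I]
    rw [intervalIntegral.integral_mul_const]
    simp only [qPow]
    rw [integral_exp_mul_complex hc]
    simp [h1]

/-- The Fourier coefficients of the sum of a series in `q` are the coefficients of the series. -/
lemma fourierCoef_of_hasSum {a : ℤ → ℂ} {f : ℍ → ℂ}
    (hf : ∀ z : ℍ, HasSum (fun n => a n * qPow n z) (f z)) (n : ℤ) : fourierCoef f n = a n := by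
  have hs : ∀ x : ℝ, HasSum (fun k => a k * qPow (k - n) (x + Complex.I))
      ((f ∘ ofComplex) (x + Complex.I) * qPow (-n) (x + Complex.I)) := by
    intro x
    have hx : 0 < ((x : ℂ) + Complex.I).im := by simp
    rw [Function.comp_apply, ofComplex_apply_of_im_pos hx]
    refine ((hf ⟨_, hx⟩).mul_right (qPow (-n) (x + Complex.I))).congr_fun fun k => ?_
    rw [sub_eq_add_neg, qPow_add, ← mul_assoc]
  -- The norm of a term depends only on the height, so a constant dominates it along the whole
  -- segment.
  have hb : ∀ (k : ℤ) (x : ℝ), ‖a k * qPow (k - n) (x + Complex.I)‖ =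
      ‖a k * qPow (k - n) ((0 : ℝ) + Complex.I)‖ := by
    intro k x
    rw [norm_mul, norm_mul, norm_qPow, norm_qPow]
    simp
  have h := intervalIntegral.hasSum_integral_of_dominated_convergence (μ := volume)
    (a := 0) (b := 1) (F := fun k (x : ℝ) => a k * qPow (k - n) (x + Complex.I))
    (fun k _ => ‖a k * qPow (k - n) ((0 : ℝ) + Complex.I)‖)
    (fun k => (Continuous.mul continuous_const
      ((continuous_qPow _).comp (by fun_prop))).aestronglyMeasurable)
    (fun k => .of_forall fun x _ => (hb k x).le)
    (.of_forall fun x _ => (hs 0).summable.norm) (by simp)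
    (.of_forall fun x _ => hs x)
  refine h.unique ?_
  simp_rw [intervalIntegral.integral_const_mul, integral_qPow, sub_eq_zero]
  convert! hasSum_ite_eq n (a n) using 2 with k
  split_ifs with h
  · rw [h, mul_one]
  · rw [mul_zero]

/-! ### Bol's identity -/

section Bol

open scoped ModularForm

lemma iterD_succ (n : ℕ) (f : ℍ → ℂ) :
    iterD (n + 1) f = Derivative.normalizedDerivOfComplex (iterD n f) :=
  Function.iterate_succ_apply' _ _ _

lemma mdiff_denom (γ : SL(2, ℤ)) : MDiff (fun z : ℍ => denom γ z) := by
  rw [UpperHalfPlane.mdifferentiable_iff]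
  have h : DifferentiableOn ℂ (fun z : ℂ => denom γ z) {z | 0 < z.im} := by
    unfold denom
    fun_prop
  exact h.congr fun z hz => by rw [Function.comp_apply, ofComplex_apply_of_im_pos hz]

lemma normalizedDeriv_denom (γ : SL(2, ℤ)) :
    Derivative.normalizedDerivOfComplex (fun z : ℍ => denom γ z) =
      fun _ => (2 * Real.pi * Complex.I)⁻¹ * (γ 1 0 : ℂ) := by
  ext z
  have he : (fun z : ℍ => denom γ z) ∘ ofComplex =ᶠ[nhds (z : ℂ)] fun z => denom γ z ^ (1 : ℤ) := by
    filter_upwards [UpperHalfPlane.isOpen_upperHalfPlaneSet.mem_nhds z.im_pos] with w hw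
    rw [Function.comp_apply, ofComplex_apply_of_im_pos hw, zpow_one]
  rw [Derivative.normalizedDerivOfComplex, he.deriv_eq, deriv_denom_zpow]
  simp

/-- Leibniz rule: the derivative of `cz + d` is constant, so only two terms survive. -/
lemma iterD_denom_mul (γ : SL(2, ℤ)) (n : ℕ) {f : ℍ → ℂ} (hf : MDiff f) :
    iterD (n + 1) ((fun z : ℍ => denom γ z) * f) = (fun z : ℍ => denom γ z) * iterD (n + 1) f +
      ((n + 1) * ((2 * Real.pi * Complex.I)⁻¹ * (γ 1 0 : ℂ))) • iterD n f := by
  induction n with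
  | zero =>
    rw [iterD_succ, iterD_succ]
    change Derivative.normalizedDerivOfComplex (_ * f) =
      _ * Derivative.normalizedDerivOfComplex f + _ • f
    rw [Derivative.normalizedDerivOfComplex_mul _ _ (mdiff_denom γ) hf, normalizedDeriv_denom]
    ext z
    simp
    ring
  | succ n ih =>
    have h1 := iterD_mdiff (n + 1) hf
    have h2 := iterD_mdiff n hf
    rw [iterD_succ, ih, Derivative.normalizedDerivOfComplex_add _ _ ((mdiff_denom γ).mul h1)
      (h2.const_smul _), Derivative.normalizedDerivOfComplex_mul _ _ (mdiff_denom γ) h1,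
      Derivative.normalizedDerivOfComplex_smul _ _ h2, normalizedDeriv_denom, ← iterD_succ,
      ← iterD_succ]
    ext z
    simp
    ring

/-- Bol's identity: `Dⁿ` intertwines the slash actions of weights `1 - n` and `1 + n`. -/
lemma iterD_slash (γ : SL(2, ℤ)) (n : ℕ) {f : ℍ → ℂ} (hf : MDiff f) :
    iterD n (f ∣[(1 - n : ℤ)] γ) = iterD n f ∣[(1 + n : ℤ)] γ := by
  induction n with
  | zero => simp [iterD]
  | succ n ih =>
    have h : f ∣[(1 - (n + 1 : ℕ) : ℤ)] γ = (fun z : ℍ => denom γ z) * (f ∣[(1 - n : ℤ)] γ) := by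
      ext z
      rw [Pi.mul_apply, ModularForm.SL_slash_apply, ModularForm.SL_slash_apply,
        show -(1 - (n + 1 : ℕ) : ℤ) = 1 + -(1 - n) by push_cast; ring,
        zpow_one_add₀ (denom_ne_zero _ _)]
      ring
    have hm : MDiff (f ∣[(1 - n : ℤ)] γ) := hf.slash _ _
    -- The second Leibniz term cancels the correction term by which the derivative of a slashed
    -- function fails to be the slashed derivative.
    rw [h, iterD_denom_mul γ n hm, iterD_succ, ih,
      Derivative.normalizedDerivOfComplex_SL_slash (iterD_mdiff n hf), ← iterD_succ]
    ext z
    have hz := denom_ne_zero (γ : GL (Fin 2) ℝ) z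
    simp only [Pi.add_apply, Pi.mul_apply, Pi.sub_apply, Pi.smul_apply, smul_eq_mul,
      ModularForm.SL_slash_apply]
    rw [show -(1 + n + 2 : ℤ) = -(1 + (n + 1 : ℕ)) + -1 by push_cast; ring,
      zpow_add₀ hz, zpow_neg_one]
    push_cast
    field_simp
    ring

lemma slash_eq_iff (w : ℤ) (γ : SL(2, ℤ)) (f : ℍ → ℂ) :
    f ∣[w] γ = f ↔ ∀ z : ℍ, f (γ • z) = ((γ 1 0 : ℂ) * z + γ 1 1) ^ w * f z := by
  rw [funext_iff]
  refine forall_congr' fun z => ?_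
  have hz := denom_ne_zero (γ : GL (Fin 2) ℝ) z
  have hd : denom (γ : GL (Fin 2) ℝ) z = (γ 1 0 : ℂ) * z + γ 1 1 := by simp [denom]
  rw [ModularForm.SL_slash_apply, hd, zpow_neg, ← div_eq_mul_inv,
    div_eq_iff (zpow_ne_zero _ (hd ▸ hz)), mul_comm]

end Bol

/-! ### The forms `D^{k-1} g` -/

lemma fourierCoef_iterD {w : ℤ} {g : ℍ → ℂ} (hg : IsWeaklyHolomorphic w g) (j : ℕ) (n : ℤ) :
    fourierCoef (iterD j g) n = n ^ j * fourierCoef g n :=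
  fourierCoef_of_hasSum (a := fun n : ℤ => (n : ℂ) ^ j * fourierCoef g n)
    (hasSum_iterD hg.hasSum j) n

lemma IsWeaklyHolomorphic.iterD {k : ℕ} (hk : 1 ≤ k) {g : ℍ → ℂ}
    (hg : IsWeaklyHolomorphic (2 - k) g) : IsWeaklyHolomorphic k (iterD (k - 1) g) where
  mdiff := iterD_mdiff _ hg.mdiff
  modular γ := by
    rw [← slash_eq_iff]
    have h := iterD_slash γ (k - 1) hg.mdiff
    have e1 : (1 - (k - 1 : ℕ) : ℤ) = 2 - k := by omega
    have e2 : (1 + (k - 1 : ℕ) : ℤ) = k := by omega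
    rw [e1, e2, (slash_eq_iff _ γ g).mpr (hg.modular γ)] at h
    exact h.symm
  principal := by
    obtain ⟨N, hN⟩ := hg.principal
    exact ⟨N, fun n hn => by rw [fourierCoef_iterD hg, hN n hn, mul_zero]⟩
  hasSum z := by
    simp_rw [fourierCoef_iterD hg]
    exact hasSum_iterD hg.hasSum _ z

lemma exactForms_le (K : Type) [Field K] [Algebra K ℂ] {k : ℕ} (hk : 2 ≤ k) :
    exactForms K k ≤ weakCuspForms K k := by
  rintro _ ⟨g, hg, rfl⟩
  refine ⟨⟨hg.1.iterD (by omega), fun n => ?_⟩, ?_⟩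
  · obtain ⟨a, ha⟩ := hg.2 n
    exact ⟨n ^ (k - 1) * a, by rw [fourierCoef_iterD hg.1, map_mul, ha]; simp⟩
  -- The constant term is multiplied by `0 ^ (k - 1)`, which vanishes since `k ≥ 2`.
  · rw [fourierCoef_iterD hg.1, Int.cast_zero, zero_pow (by omega), zero_mul]

/-! ### Iterated primitives of a series in `q` -/

lemma qSeries_add {a b : ℤ → ℂ} (ha : QSummable a) (hb : QSummable b) {z : ℂ} (hz : 0 < z.im) :
    qSeries (a + b) z = qSeries a z + qSeries b z := by
  refine ((ha.hasSum hz).add (hb.hasSum hz)).tsum_eq.symm ▸ ?_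
  exact tsum_congr fun n => by rw [Pi.add_apply, add_mul]

lemma qSeries_smul (c : ℂ) (a : ℤ → ℂ) (z : ℂ) : qSeries (c • a) z = c * qSeries a z := by
  simp only [qSeries, Pi.smul_apply, smul_eq_mul, mul_assoc, tsum_mul_left]

lemma qSeries_add_one (a : ℤ → ℂ) (z : ℂ) : qSeries a (z + 1) = qSeries a z := by
  simp only [qSeries, qPow_add_arg, qPow_one_arg, mul_one]

/-- The coefficients of the part of the `r`-fold primitive of `∑ aₙ qⁿ` that is a series in `q`. -/
def primCoef (a : ℤ → ℂ) (r : ℕ) (n : ℤ) : ℂ :=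
  if n = 0 then 0 else a n / (2 * Real.pi * Complex.I * n) ^ r

/-- The `r`-fold primitive `∑_{n ≠ 0} aₙ (2 π i n)^{-r} qⁿ + a₀ z ^ r / r!` of `∑ aₙ qⁿ`. -/
def iterPrim (a : ℤ → ℂ) (r : ℕ) (z : ℂ) : ℂ :=
  qSeries (primCoef a r) z + a 0 * z ^ r / r.factorial

/-- Passing to primitives divides coefficients by numbers of norm at least one, so convergence is
inherited. -/
lemma one_le_norm_two_pi_mul_int {n : ℤ} (hn : n ≠ 0) :
    1 ≤ ‖(2 * Real.pi * Complex.I * n : ℂ)‖ := by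
  have h1 : (1 : ℝ) ≤ |(n : ℝ)| := by exact_mod_cast Int.one_le_abs hn
  have h2 := Real.two_le_pi
  have h3 : ‖(2 * Real.pi * Complex.I * n : ℂ)‖ = 2 * Real.pi * |(n : ℝ)| := by
    simp [abs_of_pos Real.pi_pos]
  rw [h3]
  nlinarith

lemma QSummable.primCoef {a : ℤ → ℂ} (ha : QSummable a) (r : ℕ) : QSummable (primCoef a r) := by
  refine ha.of_norm_le fun n => ?_
  rw [_root_.primCoef]
  split_ifs with hn
  · simp
  · rw [norm_div, norm_pow]
    exact div_le_self (norm_nonneg _) (one_le_pow₀ (one_le_norm_two_pi_mul_int hn))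

lemma primCoef_add (a b : ℤ → ℂ) (r : ℕ) : primCoef (a + b) r = primCoef a r + primCoef b r := by
  ext n
  simp only [primCoef, Pi.add_apply]
  split_ifs <;> ring

lemma primCoef_smul (c : ℂ) (a : ℤ → ℂ) (r : ℕ) : primCoef (c • a) r = c • primCoef a r := by
  ext n
  simp only [primCoef, Pi.smul_apply, smul_eq_mul]
  split_ifs <;> ring

lemma iterPrim_add {a b : ℤ → ℂ} (ha : QSummable a) (hb : QSummable b) (r : ℕ) {z : ℂ}
    (hz : 0 < z.im) : iterPrim (a + b) r z = iterPrim a r z + iterPrim b r z := by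
  rw [iterPrim, primCoef_add, qSeries_add (ha.primCoef r) (hb.primCoef r) hz, iterPrim, iterPrim,
    Pi.add_apply]
  ring

lemma iterPrim_smul (c : ℂ) (a : ℤ → ℂ) (r : ℕ) (z : ℂ) :
    iterPrim (c • a) r z = c * iterPrim a r z := by
  rw [iterPrim, primCoef_smul, qSeries_smul, iterPrim, Pi.smul_apply, smul_eq_mul]
  ring

/-- The constant term omitted by `primCoef` returns as `a 0 * z ^ 0 / 0!`. -/
lemma iterPrim_zero {a : ℤ → ℂ} (ha : QSummable a) {z : ℂ} (hz : 0 < z.im) :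
    iterPrim a 0 z = qSeries a z := by
  have h0 : HasSum (fun n : ℤ => if n = 0 then a 0 else 0) (a 0) := hasSum_ite_eq 0 (a 0)
  have h := ((ha.primCoef 0).hasSum hz).add h0
  rw [iterPrim, pow_zero, mul_one, Nat.factorial_zero, Nat.cast_one, div_one, ← h.tsum_eq, qSeries]
  refine tsum_congr fun n => ?_
  rw [primCoef]
  split_ifs with hn <;> simp [hn, qPow_zero]

lemma hasDerivAt_iterPrim {a : ℤ → ℂ} (ha : QSummable a) (r : ℕ) {z : ℂ} (hz : 0 < z.im) :
    HasDerivAt (iterPrim a (r + 1)) (iterPrim a r z) z := by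
  have h1 := (ha.primCoef (r + 1)).hasDerivAt hz
  have h2 : HasDerivAt (fun z : ℂ => a 0 * z ^ (r + 1) / (r + 1).factorial)
      (a 0 * z ^ r / r.factorial) z := by
    convert! ((hasDerivAt_pow (r + 1) z).const_mul (a 0)).div_const
      ((r + 1).factorial : ℂ) using 1
    rw [Nat.factorial_succ]
    have : (r.factorial : ℂ) ≠ 0 := by exact_mod_cast r.factorial_ne_zero
    have : (r : ℂ) + 1 ≠ 0 := by exact_mod_cast r.succ_ne_zero
    push_cast
    field_simp
  have e : (fun n : ℤ => 2 * Real.pi * Complex.I * n * primCoef a (r + 1) n) = primCoef a r := by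
    ext n
    simp only [primCoef]
    split_ifs with hn
    · simp
    · have : (n : ℂ) ≠ 0 := by exact_mod_cast hn
      have := Complex.two_pi_I_ne_zero
      rw [pow_succ]
      field_simp
  rw [e] at h1
  exact h1.add h2

/-! ### The Eichler kernel -/

/-- A primitive of `f(w) (w - z)^m` with respect to `w`, where `f = ∑ aₙ qⁿ`. -/
def eichlerKernel (a : ℤ → ℂ) (m : ℕ) (w z : ℂ) : ℂ :=
  ∑ i ∈ Finset.range (m + 1),
    (-1) ^ i * m.descFactorial i * (w - z) ^ (m - i) * iterPrim a (i + 1) w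

/-- Integration by parts in telescoping form: the `i`-th summand has derivative `t i - t (i + 1)`.
-/
lemma hasDerivAt_eichlerKernel {a : ℤ → ℂ} (ha : QSummable a) (m : ℕ) {w : ℂ} (hw : 0 < w.im)
    (z : ℂ) :
    HasDerivAt (fun w => eichlerKernel a m w z) (qSeries a w * (w - z) ^ m) w := by
  set t : ℕ → ℂ := fun i => (-1) ^ i * m.descFactorial i * (w - z) ^ (m - i) * iterPrim a i w
  have ht : ∀ i ∈ Finset.range (m + 1), HasDerivAt
      (fun w => (-1) ^ i * m.descFactorial i * (w - z) ^ (m - i) * iterPrim a (i + 1) w)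
      (t i - t (i + 1)) w := by
    intro i hi
    have h := ((((hasDerivAt_id w).sub_const z).pow (m - i)).const_mul
      ((-1) ^ i * (m.descFactorial i : ℂ))).mul (hasDerivAt_iterPrim ha i hw)
    convert! h using 1
    have h1 : (m.descFactorial (i + 1) : ℂ) = ((m - i : ℕ) : ℂ) * m.descFactorial i := by
      rw [Nat.descFactorial_succ]
      push_cast
      rfl
    simp only [t, h1, id, Nat.sub_sub, Pi.pow_apply]
    ring
  have h := HasDerivAt.fun_sum ht
  rw [Finset.sum_range_sub'] at h
  convert! h using 1
  -- The last term `t (m + 1)` is zero because `m.descFactorial (m + 1) = 0`; the truncated exponent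
  -- there is harmless.
  simp [t, iterPrim_zero ha hw, mul_comm]

lemma eichlerKernel_self (a : ℤ → ℂ) (m : ℕ) (z : ℂ) :
    eichlerKernel a m z z = (-1) ^ m * m.factorial * iterPrim a (m + 1) z := by
  rw [eichlerKernel, Finset.sum_range_succ, Finset.sum_eq_zero]
  · simp [Nat.descFactorial_self]
  · intro i hi
    have : m - i ≠ 0 := by
      have := Finset.mem_range.mp hi
      omega
    simp [this]

open Polynomial in
/-- The Eichler kernel `z ↦ eichlerKernel a m w z` as a polynomial of degree at most `m`. -/
def kernelPoly (a : ℤ → ℂ) (m : ℕ) (w : ℂ) : PolyLE ℂ m :=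
  .ofPoly (∑ i ∈ Finset.range (m + 1),
    C ((-1) ^ i * m.descFactorial i * iterPrim a (i + 1) w) * (C w - X) ^ (m - i)) <| by
    refine degree_le_of_natDegree_le (natDegree_sum_le_of_forall_le _ _ fun i _ => ?_)
    refine (natDegree_C_mul_le _ _).trans ((natDegree_pow_le_of_le (m - i) (m := 1) ?_).trans ?_)
    · exact (natDegree_sub_le _ _).trans (by simp)
    · omega

lemma kernelPoly_eval (a : ℤ → ℂ) (m : ℕ) (w z : ℂ) :
    (kernelPoly a m w).toPoly.eval z = eichlerKernel a m w z := by
  rw [kernelPoly, PolyLE.toPoly_ofPoly, Polynomial.eval_finsetSum, eichlerKernel]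
  refine Finset.sum_congr rfl fun i _ => ?_
  simp only [Polynomial.eval_mul, Polynomial.eval_C, Polynomial.eval_pow, Polynomial.eval_sub,
    Polynomial.eval_X]
  ring

lemma eichlerKernel_add {a b : ℤ → ℂ} (ha : QSummable a) (hb : QSummable b) (m : ℕ) {w : ℂ}
    (hw : 0 < w.im) (z : ℂ) :
    eichlerKernel (a + b) m w z = eichlerKernel a m w z + eichlerKernel b m w z := by
  rw [eichlerKernel, eichlerKernel, eichlerKernel, ← Finset.sum_add_distrib]
  exact Finset.sum_congr rfl fun i _ => by rw [iterPrim_add ha hb _ hw, mul_add]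

lemma eichlerKernel_smul (c : ℂ) (a : ℤ → ℂ) (m : ℕ) (w z : ℂ) :
    eichlerKernel (c • a) m w z = c * eichlerKernel a m w z := by
  rw [eichlerKernel, eichlerKernel, Finset.mul_sum]
  exact Finset.sum_congr rfl fun i _ => by rw [iterPrim_smul, mul_left_comm]

/-- The points `(n + 1) i` are infinitely many, so polynomial identities may be tested on `ℍ`, where
`cz + d` never vanishes. -/
lemma PolyLE.ext_eval {m : ℕ} {p q : PolyLE ℂ m}
    (h : ∀ z : ℍ, p.toPoly.eval (z : ℂ) = q.toPoly.eval (z : ℂ)) : p = q := by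
  refine PolyLE.toPoly_injective (Polynomial.eq_of_infinite_eval_eq _ _ ?_)
  have hi : Function.Injective fun n : ℕ => (n + 1 : ℂ) * Complex.I := by
    intro n n' hn
    have := mul_right_cancel₀ Complex.I_ne_zero hn
    exact_mod_cast add_right_cancel this
  refine (Set.infinite_range_of_injective hi).mono ?_
  rintro _ ⟨n, rfl⟩
  refine h ⟨(n + 1 : ℂ) * Complex.I, ?_⟩
  simp
  positivity

lemma kernelPoly_add {a b : ℤ → ℂ} (ha : QSummable a) (hb : QSummable b) (m : ℕ) {w : ℂ}
    (hw : 0 < w.im) : kernelPoly (a + b) m w = kernelPoly a m w + kernelPoly b m w :=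
  PolyLE.ext_eval fun z => by
    rw [map_add, Polynomial.eval_add, kernelPoly_eval, kernelPoly_eval, kernelPoly_eval,
      eichlerKernel_add ha hb m hw]

lemma kernelPoly_smul (c : ℂ) (a : ℤ → ℂ) (m : ℕ) (w : ℂ) :
    kernelPoly (c • a) m w = c • kernelPoly a m w :=
  PolyLE.ext_eval fun z => by
    rw [map_smul, Polynomial.eval_smul, kernelPoly_eval, kernelPoly_eval, eichlerKernel_smul,
      smul_eq_mul]

lemma integral_segment {a : ℤ → ℂ} (ha : QSummable a) (m : ℕ) {p q : ℂ} (hp : 0 < p.im)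
    (hq : 0 < q.im) (z : ℂ) :
    ∫ t in (0 : ℝ)..1, qSeries a (AffineMap.lineMap p q t) * (AffineMap.lineMap p q t - z) ^ m *
      (q - p) = eichlerKernel a m q z - eichlerKernel a m p z := by
  have hl : ∀ t ∈ Set.uIcc (0 : ℝ) 1, 0 < (AffineMap.lineMap p q t : ℂ).im := by
    intro t ht
    rw [Set.uIcc_of_le zero_le_one] at ht
    exact (convex_halfSpace_im_gt 0).lineMap_mem hp hq ht
  have hlc : Continuous fun t : ℝ => (AffineMap.lineMap p q t : ℂ) :=
    AffineMap.lineMap_continuous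
  have hd : ∀ t ∈ Set.uIcc (0 : ℝ) 1, HasDerivAt
      (fun t : ℝ => eichlerKernel a m (AffineMap.lineMap p q t) z)
      (qSeries a (AffineMap.lineMap p q t) * (AffineMap.lineMap p q t - z) ^ m * (q - p)) t :=
    fun t ht => (hasDerivAt_eichlerKernel ha m (hl t ht) z).comp_of_eq t
      AffineMap.hasDerivAt_lineMap rfl
  have hc : ContinuousOn (fun t : ℝ => qSeries a (AffineMap.lineMap p q t) *
      (AffineMap.lineMap p q t - z) ^ m * (q - p)) (Set.uIcc 0 1) := by
    refine ContinuousOn.mul (ContinuousOn.mul ?_ ?_) continuousOn_const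
    · exact fun t ht => ((ha.hasDerivAt (hl t ht)).continuousAt.comp
        hlc.continuousAt).continuousWithinAt
    · exact ((hlc.sub continuous_const).pow m).continuousOn
  rw [intervalIntegral.integral_eq_sub_of_hasDerivAt hd hc.intervalIntegrable]
  simp

/-! ### Cocycles from functions on the upper half-plane -/

lemma coe_smul_eq (γ : SL(2, ℤ)) (z : ℍ) :
    ((γ • z : ℍ) : ℂ) = ((γ 0 0 : ℂ) * z + γ 0 1) / ((γ 1 0 : ℂ) * z + γ 1 1) := by
  simp [UpperHalfPlane.specialLinearGroup_apply]

lemma factor_ne_zero (γ : SL(2, ℤ)) (z : ℍ) : (γ 1 0 : ℂ) * z + γ 1 1 ≠ 0 := by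
  simpa [denom] using denom_ne_zero (γ : GL (Fin 2) ℝ) z

lemma det_eq_one (γ : SL(2, ℤ)) : (γ 0 0 : ℂ) * γ 1 1 - γ 0 1 * γ 1 0 = 1 := by
  have h := γ.det_coe
  rw [Matrix.det_fin_two] at h
  exact_mod_cast h

lemma factor_mul (g₂ g₁ : SL(2, ℤ)) (z : ℍ) :
    ((g₂ * g₁) 1 0 : ℂ) * z + (g₂ * g₁) 1 1 =
      ((g₂ 1 0 : ℂ) * (g₁ • z : ℍ) + g₂ 1 1) * ((g₁ 1 0 : ℂ) * z + g₁ 1 1) := by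
  rw [coe_smul_eq, add_mul, ← mul_div_assoc, div_mul_cancel₀ _ (factor_ne_zero g₁ z)]
  simp [Matrix.mul_apply, Fin.sum_univ_two]
  ring

lemma coe_smul_sub_coe_smul (γ : SL(2, ℤ)) (u z : ℍ) :
    ((γ • u : ℍ) : ℂ) - (γ • z : ℍ) =
      (u - z) / (((γ 1 0 : ℂ) * u + γ 1 1) * ((γ 1 0 : ℂ) * z + γ 1 1)) := by
  rw [coe_smul_eq, coe_smul_eq, div_sub_div _ _ (factor_ne_zero γ u) (factor_ne_zero γ z)]
  congr 1
  linear_combination ((u : ℂ) - z) * det_eq_one γ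

lemma polySlash_eval_coe (m : ℕ) (γ : SL(2, ℤ)) (p : PolyLE ℂ m) (z : ℍ) :
    (polySlash ℂ m γ p).toPoly.eval (z : ℂ) =
      ((γ 1 0 : ℂ) * z + γ 1 1) ^ m * p.toPoly.eval ((γ • z : ℍ) : ℂ) := by
  rw [polySlash_eval m γ p z (factor_ne_zero γ z), coe_smul_eq]

lemma dZero_eval (m : ℕ) (p : PolyLE ℂ m) (γ : SL(2, ℤ)) (z : ℍ) :
    (dZero ℂ m p γ).toPoly.eval (z : ℂ) =
      dZeroFun m (fun z => p.toPoly.eval (z : ℂ)) γ z := by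
  rw [dZeroFun, ← polySlash_eval_coe]
  simp [dZero]

lemma mem_cocycles_iff {K : Type} [Field K] {m : ℕ} {σ : SL(2, ℤ) → PolyLE K m} :
    σ ∈ cocycles K m ↔ ∀ g₁ g₂, σ (g₂ * g₁) = polySlash K m g₁ (σ g₂) + σ g₁ := by
  rw [cocycles, LinearMap.mem_ker, funext_iff, Prod.forall]
  refine forall₂_congr fun g₁ g₂ => ?_
  simp only [dOne, LinearMap.pi_apply, LinearMap.add_apply, LinearMap.sub_apply,
    LinearMap.comp_apply, LinearMap.proj_apply, Pi.zero_apply]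
  rw [sub_add_eq_add_sub, sub_eq_zero, eq_comm]

/-- The cocycle relation is formal for a coboundary of any function on `ℍ`; `v` need not be a
polynomial. -/
lemma mem_cocycles_of_dZeroFun {m : ℕ} {σ : SL(2, ℤ) → PolyLE ℂ m} (v : ℍ → ℂ)
    (h : ∀ γ (z : ℍ), (σ γ).toPoly.eval (z : ℂ) = dZeroFun m v γ z) : σ ∈ cocycles ℂ m := by
  rw [mem_cocycles_iff]
  intro g₁ g₂
  refine PolyLE.ext_eval fun z => ?_
  rw [map_add, Polynomial.eval_add, polySlash_eval_coe, h, h, h, dZeroFun, dZeroFun, dZeroFun,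
    factor_mul, mul_smul, mul_pow]
  ring

lemma mem_vanishAtT_of_dZeroFun {m : ℕ} {σ : SL(2, ℤ) → PolyLE ℂ m} (v : ℍ → ℂ)
    (h : ∀ γ (z : ℍ), (σ γ).toPoly.eval (z : ℂ) = dZeroFun m v γ z)
    (hv : ∀ z : ℍ, v (ModularGroup.T • z) = v z) : σ ∈ vanishAtT ℂ m := by
  rw [vanishAtT, LinearMap.mem_ker, LinearMap.proj_apply]
  refine PolyLE.ext_eval fun z => ?_
  rw [h, dZeroFun, hv]
  simp [ModularGroup.T]

/-! ### The Eichler cochain of a form -/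

/-- `γ ↦ ∫_i^{γ⁻¹ i} f(w) (w - z)^m dw` for `f = ∑ aₙ qⁿ`. -/
def eichlerCochain (a : ℤ → ℂ) (m : ℕ) (γ : SL(2, ℤ)) : PolyLE ℂ m :=
  kernelPoly a m (γ⁻¹ • UpperHalfPlane.I : ℍ) - kernelPoly a m Complex.I

lemma eichlerCochain_eval (a : ℤ → ℂ) (m : ℕ) (γ : SL(2, ℤ)) (z : ℂ) :
    (eichlerCochain a m γ).toPoly.eval z =
      eichlerKernel a m (γ⁻¹ • UpperHalfPlane.I : ℍ) z - eichlerKernel a m Complex.I z := by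
  rw [eichlerCochain, map_sub, Polynomial.eval_sub, kernelPoly_eval, kernelPoly_eval]

lemma IsWeaklyHolomorphic.qSummable {w : ℤ} {f : ℍ → ℂ} (hf : IsWeaklyHolomorphic w f) :
    QSummable (fourierCoef f) := fun z => (hf.hasSum z).summable

lemma IsWeaklyHolomorphic.qSeries_eq {w : ℤ} {f : ℍ → ℂ} (hf : IsWeaklyHolomorphic w f) (z : ℍ) :
    qSeries (fourierCoef f) z = f z := (hf.hasSum z).tsum_eq

lemma IsWeaklyHolomorphic.isEichlerCocycle {k : ℕ} {f : ℍ → ℂ} (hf : IsWeaklyHolomorphic k f) :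
    IsEichlerCocycle k f (eichlerCochain (fourierCoef f) (k - 2)) := by
  intro γ z
  rw [eichlerCochain_eval, eichlerIntegral,
    ← integral_segment hf.qSummable (k - 2) (by simp) (γ⁻¹ • UpperHalfPlane.I : ℍ).im_pos]
  refine intervalIntegral.integral_congr fun t ht => ?_
  rw [Set.uIcc_of_le zero_le_one] at ht
  have hl : 0 < (AffineMap.lineMap Complex.I
      ((γ⁻¹ • UpperHalfPlane.I : ℍ) : ℂ) t : ℂ).im :=
    (convex_halfSpace_im_gt 0).lineMap_mem (by simp)
      (γ⁻¹ • UpperHalfPlane.I : ℍ).im_pos ht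
  simp only [Function.comp_apply]
  rw [ofComplex_apply_of_im_pos hl, ← hf.qSeries_eq]

lemma hasDerivAt_coe_smul (γ : SL(2, ℤ)) {u : ℂ} (hu : 0 < u.im) :
    HasDerivAt (fun u => ((γ • ofComplex u : ℍ) : ℂ))
      (1 / ((γ 1 0 : ℂ) * u + γ 1 1) ^ 2) u := by
  have hdet : (γ : GL (Fin 2) ℝ).val.det = 1 := by
    rw [← Matrix.GeneralLinearGroup.val_det_apply]
    simp
  have h := (UpperHalfPlane.hasStrictDerivAt_smul (g := (γ : GL (Fin 2) ℝ))
    (hdet ▸ zero_lt_one) ⟨u, hu⟩).hasDerivAt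
  rw [hdet] at h
  simpa [denom] using h

/-- The derivative in the first argument vanishes. With `j(u) = cu + d`, the factors `j(u)^k` from
`f(γu)`, `(j(u) j(z))^{2-k}` from `(γu - γz)^{k-2}` and `j(u)^{-2}` from `d(γu)` combine with
`j(z)^{k-2}` to `1`. -/
lemma eichlerKernel_smul_smul {k : ℕ} (hk : 2 ≤ k) {f : ℍ → ℂ} (hf : IsWeaklyHolomorphic k f)
    (γ : SL(2, ℤ)) (z p q : ℍ) :
    ((γ 1 0 : ℂ) * z + γ 1 1) ^ (k - 2) *
        eichlerKernel (fourierCoef f) (k - 2) (γ • p : ℍ) (γ • z : ℍ) -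
        eichlerKernel (fourierCoef f) (k - 2) p z =
      ((γ 1 0 : ℂ) * z + γ 1 1) ^ (k - 2) *
        eichlerKernel (fourierCoef f) (k - 2) (γ • q : ℍ) (γ • z : ℍ) -
        eichlerKernel (fourierCoef f) (k - 2) q z := by
  set W : ℂ → ℂ := fun u => ((γ 1 0 : ℂ) * z + γ 1 1) ^ (k - 2) *
    eichlerKernel (fourierCoef f) (k - 2) (γ • ofComplex u : ℍ) (γ • z : ℍ) -
    eichlerKernel (fourierCoef f) (k - 2) u z with hW
  have hd : ∀ u : ℂ, 0 < u.im → HasDerivAt W 0 u := by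
    intro u hu
    have h1 := (hasDerivAt_eichlerKernel hf.qSummable (k - 2) (γ • ofComplex u : ℍ).im_pos
      ((γ • z : ℍ) : ℂ)).comp u (hasDerivAt_coe_smul γ hu)
    have h2 := (h1.const_mul (((γ 1 0 : ℂ) * z + γ 1 1) ^ (k - 2))).sub
      (hasDerivAt_eichlerKernel hf.qSummable (k - 2) hu (z : ℂ))
    convert! h2 using 1
    have hJu := factor_ne_zero γ ⟨u, hu⟩
    have hJz := factor_ne_zero γ z
    have hu' : ofComplex u = ⟨u, hu⟩ := ofComplex_apply_of_im_pos hu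
    have hq : qSeries (fourierCoef f) u = f ⟨u, hu⟩ := hf.qSeries_eq ⟨u, hu⟩
    rw [hf.qSeries_eq, hu', hf.modular, coe_smul_sub_coe_smul, hq, zpow_natCast]
    obtain ⟨m, rfl⟩ := Nat.exists_eq_add_of_le' hk
    simp only [Nat.add_sub_cancel]
    change (γ 1 0 : ℂ) * u + γ 1 1 ≠ 0 at hJu
    rw [div_pow, mul_pow, pow_add]
    field_simp
    ring
  -- A function with zero derivative on the connected set `ℍ` takes the same value at `p` and `q`.
  have hs : IsPreconnected {u : ℂ | 0 < u.im} := (convex_halfSpace_im_gt 0).isPreconnected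
  have h := UpperHalfPlane.isOpen_upperHalfPlaneSet.is_const_of_deriv_eq_zero hs
    (fun u hu => (hd u hu).differentiableAt.differentiableWithinAt)
    (fun u hu => (hd u hu).deriv) p.im_pos q.im_pos
  simpa [hW] using h

lemma eichlerCochain_eval_eq_dZeroFun {k : ℕ} (hk : 2 ≤ k) {f : ℍ → ℂ}
    (hf : IsWeaklyHolomorphic k f) (γ : SL(2, ℤ)) (z : ℍ) :
    (eichlerCochain (fourierCoef f) (k - 2) γ).toPoly.eval (z : ℂ) =
      dZeroFun (k - 2) (fun z => eichlerKernel (fourierCoef f) (k - 2) Complex.I z -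
        eichlerKernel (fourierCoef f) (k - 2) z z) γ z := by
  -- The base point `γ⁻¹i` produces the segment integral and the base point `z` the diagonal values.
  have h := eichlerKernel_smul_smul hk hf γ z (γ⁻¹ • UpperHalfPlane.I) z
  rw [smul_inv_smul, UpperHalfPlane.coe_I] at h
  rw [eichlerCochain_eval, dZeroFun]
  linear_combination -h

lemma eichlerCochain_mem_cocycles {k : ℕ} (hk : 2 ≤ k) {f : ℍ → ℂ}
    (hf : IsWeaklyHolomorphic k f) :
    eichlerCochain (fourierCoef f) (k - 2) ∈ cocycles ℂ (k - 2) :=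
  mem_cocycles_of_dZeroFun _ (eichlerCochain_eval_eq_dZeroFun hk hf)

lemma eichlerCochain_add {a b : ℤ → ℂ} (ha : QSummable a) (hb : QSummable b) (m : ℕ) :
    eichlerCochain (a + b) m = eichlerCochain a m + eichlerCochain b m := by
  ext1 γ
  rw [Pi.add_apply, eichlerCochain, eichlerCochain, eichlerCochain,
    kernelPoly_add ha hb m (γ⁻¹ • UpperHalfPlane.I : ℍ).im_pos, kernelPoly_add ha hb m (by simp)]
  abel

lemma eichlerCochain_smul (c : ℂ) (a : ℤ → ℂ) (m : ℕ) :
    eichlerCochain (c • a) m = c • eichlerCochain a m := by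
  ext1 γ
  rw [Pi.smul_apply, eichlerCochain, eichlerCochain, kernelPoly_smul, kernelPoly_smul, smul_sub]

lemma eichlerCochain_iterD_mem_coboundaries {k : ℕ} (hk : 2 ≤ k) {g : ℍ → ℂ}
    (hg : IsWeaklyHolomorphic (2 - k) g) :
    eichlerCochain (fourierCoef (iterD (k - 1) g)) (k - 2) ∈ coboundaries ℂ (k - 2) := by
  have hf : IsWeaklyHolomorphic k (iterD (k - 1) g) := hg.iterD (by omega)
  set a := fourierCoef (iterD (k - 1) g) with ha
  -- The factor `(-1)^(k-2) (k-2)!` comes from the diagonal of the kernel, and the power of `2πi`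
  -- from `D = (2πi)⁻¹ d/dz`.
  set c : ℂ := (-1) ^ (k - 2) * (k - 2).factorial * ((2 * Real.pi * Complex.I) ^ (k - 1))⁻¹ with hc
  have hk1 : k - 2 + 1 = k - 1 := by omega
  have ha' : ∀ n, a n = n ^ (k - 1) * fourierCoef g n := fourierCoef_iterD hg (k - 1)
  have hK : ∀ z : ℍ, eichlerKernel a (k - 2) z z = c * (g z - fourierCoef g 0) := by
    intro z
    have h0 : HasSum (fun n : ℤ => if n = 0 then fourierCoef g 0 else 0) (fourierCoef g 0) :=
      hasSum_ite_eq 0 _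
    have hs := ((hg.hasSum z).sub h0).mul_left (((2 * Real.pi * Complex.I) ^ (k - 1))⁻¹)
    have h1 : qSeries (primCoef a (k - 1)) z =
        ((2 * Real.pi * Complex.I) ^ (k - 1))⁻¹ * (g z - fourierCoef g 0) := by
      rw [← hs.tsum_eq, qSeries]
      refine tsum_congr fun n => ?_
      rw [primCoef]
      split_ifs with hn
      · simp [hn, qPow_zero]
      · have : (n : ℂ) ≠ 0 := by exact_mod_cast hn
        have := Complex.two_pi_I_ne_zero
        rw [ha', mul_pow]
        field_simp
        ring
    have h2 : a 0 = 0 := by rw [ha', Int.cast_zero, zero_pow (by omega), zero_mul]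
    rw [eichlerKernel_self, hk1, iterPrim, h1, h2, hc]
    ring
  set b : PolyLE ℂ (k - 2) := .ofPoly (Polynomial.C (c * fourierCoef g 0))
    (Polynomial.degree_C_le.trans (by exact_mod_cast Nat.zero_le _)) with hb
  -- The cochain is the coboundary of `K(i, z) - c g(z) + c b₀`, with `b₀` the constant term of `g`.
  -- The middle term is invariant by `hm` below, and the rest is this polynomial.
  refine ⟨kernelPoly a (k - 2) Complex.I + b, ?_⟩
  ext1 γ
  refine PolyLE.ext_eval fun z => ?_
  have hbe : ∀ z, b.toPoly.eval z = c * fourierCoef g 0 := fun z => by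
    rw [hb, PolyLE.toPoly_ofPoly, Polynomial.eval_C]
  have hJ := factor_ne_zero γ z
  have hm : ((γ 1 0 : ℂ) * z + γ 1 1) ^ (k - 2) * g (γ • z) = g z := by
    rw [hg.modular, ← zpow_natCast, ← mul_assoc, ← zpow_add₀ hJ,
      show ((k - 2 : ℕ) : ℤ) + (2 - k) = 0 by omega, zpow_zero, one_mul]
  rw [dZero_eval, ha, eichlerCochain_eval_eq_dZeroFun hk hf, ← ha]
  simp only [dZeroFun, map_add, Polynomial.eval_add, kernelPoly_eval, hbe, hK]
  linear_combination c * hm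

/-! ### The integrals along vertical half-lines -/

lemma integrableOn_pow_mul_exp (m : ℕ) {r : ℝ} (hr : 0 < r) :
    IntegrableOn (fun t : ℝ => t ^ m * Real.exp (-(r * t))) (Set.Ioi 0) ∧
      ∫ t in Set.Ioi (0 : ℝ), t ^ m * Real.exp (-(r * t)) = m.factorial / r ^ (m + 1) := by
  have h := Real.integral_rpow_mul_exp_neg_mul_Ioi (a := m + 1) (by positivity) hr
  rw [add_sub_cancel_right, Real.Gamma_nat_eq_factorial,
    show ((m : ℝ) + 1) = ((m + 1 : ℕ) : ℝ) by push_cast; rfl, Real.rpow_natCast] at h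
  simp_rw [Real.rpow_natCast] at h
  have h' : ∫ t in Set.Ioi (0 : ℝ), t ^ m * Real.exp (-(r * t)) = m.factorial / r ^ (m + 1) := by
    rw [h, one_div, inv_pow, inv_mul_eq_div]
  refine ⟨?_, h'⟩
  -- A non-integrable function has integral `0` by convention, but the Gamma integral is nonzero.
  by_contra hi
  rw [integral_undef hi] at h'
  have : (m.factorial : ℝ) / r ^ (m + 1) ≠ 0 := by positivity
  exact this h'.symm

/-- The sign `s = ±1` encodes the direction and `0 < n * s` is the decay condition. The value does
not involve `s`, which lets the upward and downward integrals recombine into one series; the norm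
bound justifies exchanging sum and integral. -/
lemma vertical_term {n : ℤ} {s : ℝ} (hns : 0 < n * s) (m : ℕ) (z : ℂ) (hs : s ^ 2 = 1) :
    IntegrableOn (fun t : ℝ => qPow n (z + Complex.I * (s * t : ℝ)) *
      ((z + Complex.I * (s * t : ℝ)) - z) ^ m * (s * Complex.I)) (Set.Ioi 0) ∧
    ∫ t in Set.Ioi (0 : ℝ), qPow n (z + Complex.I * (s * t : ℝ)) *
      ((z + Complex.I * (s * t : ℝ)) - z) ^ m * (s * Complex.I) =
        (-1) ^ (m + 1) * m.factorial / (2 * Real.pi * Complex.I * n) ^ (m + 1) * qPow n z ∧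
    ∫ t in Set.Ioi (0 : ℝ), ‖qPow n (z + Complex.I * (s * t : ℝ)) *
      ((z + Complex.I * (s * t : ℝ)) - z) ^ m * (s * Complex.I)‖ ≤ m.factorial * ‖qPow n z‖ := by
  have hr : 0 < 2 * Real.pi * (n * s) := by have := Real.pi_pos; positivity
  obtain ⟨h1, h2⟩ := integrableOn_pow_mul_exp m hr
  have hq : ∀ t : ℝ, qPow n (z + Complex.I * (s * t : ℝ)) =
      qPow n z * (Real.exp (-(2 * Real.pi * (n * s) * t)) : ℝ) := by
    intro t
    rw [qPow_add_arg]
    congr 1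
    rw [qPow, Complex.ofReal_exp]
    congr 1
    push_cast
    linear_combination (2 * Real.pi * n * s * t : ℂ) * Complex.I_sq
  have he : ∀ t : ℝ, qPow n (z + Complex.I * (s * t : ℝ)) *
      ((z + Complex.I * (s * t : ℝ)) - z) ^ m * (s * Complex.I) =
      (qPow n z * (s * Complex.I) ^ (m + 1)) *
        ((t ^ m * Real.exp (-(2 * Real.pi * (n * s) * t)) : ℝ) : ℂ) := by
    intro t
    rw [hq, add_sub_cancel_left]
    push_cast
    ring
  have hn : (n : ℂ) ≠ 0 := by
    rintro h
    have : n = 0 := by exact_mod_cast h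
    simp [this] at hns
  have hs0 : (s : ℂ) ≠ 0 := by
    rintro h
    have : s = 0 := by exact_mod_cast h
    simp [this] at hns
  have habs : |s| = 1 := by
    rw [← sq_eq_sq₀ (abs_nonneg _) zero_le_one, sq_abs, hs, one_pow]
  simp_rw [he]
  refine ⟨h1.ofReal.const_mul _, ?_, ?_⟩
  · rw [integral_const_mul, integral_complex_ofReal, h2]
    have := Complex.two_pi_I_ne_zero
    have hpi : (Real.pi : ℂ) ≠ 0 := by exact_mod_cast Real.pi_ne_zero
    have hI : Complex.I ^ (m + 1) * Complex.I ^ (m + 1) = (-1) ^ (m + 1) := by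
      rw [← mul_pow, Complex.I_mul_I]
    push_cast
    simp only [mul_pow]
    field_simp
    linear_combination (qPow n z * m.factorial) * hI
  · have hnn : ∀ t ∈ Set.Ioi (0 : ℝ), ‖qPow n z * (s * Complex.I) ^ (m + 1) *
        ((t ^ m * Real.exp (-(2 * Real.pi * (n * s) * t)) : ℝ) : ℂ)‖ =
        ‖qPow n z‖ * (t ^ m * Real.exp (-(2 * Real.pi * (n * s) * t))) := by
      intro t ht
      have ht' : (0 : ℝ) < t := ht
      rw [norm_mul, norm_mul, norm_pow, norm_mul, Complex.norm_I, Complex.norm_real,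
        Real.norm_eq_abs, habs, Complex.norm_real, Real.norm_of_nonneg (by positivity)]
      simp
    rw [setIntegral_congr_fun measurableSet_Ioi hnn, integral_const_mul, h2, mul_comm]
    refine mul_le_mul_of_nonneg_right ?_ (norm_nonneg _)
    refine div_le_self (Nat.cast_nonneg _) (one_le_pow₀ ?_)
    have h3 : 1 ≤ ‖(2 * Real.pi * Complex.I * n : ℂ)‖ :=
      one_le_norm_two_pi_mul_int (by exact_mod_cast hn)
    have h4 : ‖(2 * Real.pi * Complex.I * n : ℂ)‖ = 2 * Real.pi * (n * s) := by
      have h5 : (n : ℝ) * s = |(n : ℝ)| := by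
        rw [← abs_of_pos hns, abs_mul, habs, mul_one]
      rw [h5]
      simp [abs_of_pos Real.pi_pos]
    rwa [h4] at h3

lemma vertical_integral {b : ℤ → ℂ} {s : ℝ} (hs : s ^ 2 = 1) (hb : ∀ n, b n ≠ 0 → 0 < n * s)
    (m : ℕ) {z : ℂ} (hsum : Summable fun n => b n * qPow n z) :
    ∫ t in Set.Ioi (0 : ℝ), (∑' n, b n * qPow n (z + Complex.I * (s * t : ℝ))) *
      ((z + Complex.I * (s * t : ℝ)) - z) ^ m * (s * Complex.I) =
    (-1) ^ (m + 1) * m.factorial * qSeries (primCoef b (m + 1)) z := by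
  have h := hasSum_integral_of_summable_integral_norm (μ := volume.restrict (Set.Ioi (0 : ℝ)))
    (F := fun (n : ℤ) (t : ℝ) => b n * (qPow n (z + Complex.I * (s * t : ℝ)) *
      ((z + Complex.I * (s * t : ℝ)) - z) ^ m * (s * Complex.I))) ?_ ?_
  · have e : ∀ t : ℝ, (∑' n, b n * qPow n (z + Complex.I * (s * t : ℝ))) *
        ((z + Complex.I * (s * t : ℝ)) - z) ^ m * (s * Complex.I) =
        ∑' n, b n * (qPow n (z + Complex.I * (s * t : ℝ)) *
          ((z + Complex.I * (s * t : ℝ)) - z) ^ m * (s * Complex.I)) := by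
      intro t
      rw [← tsum_mul_right, ← tsum_mul_right]
      exact tsum_congr fun n => by ring
    simp_rw [e]
    rw [← h.tsum_eq, qSeries, ← tsum_mul_left]
    refine tsum_congr fun n => ?_
    rw [integral_const_mul, primCoef]
    by_cases hn : b n = 0
    · simp [hn]
    · rw [(vertical_term (hb n hn) m z hs).2.1, if_neg]
      · ring
      · rintro rfl
        simpa using hb 0 hn
  · intro n
    by_cases hn : b n = 0
    · simp [hn]
    · exact (vertical_term (hb n hn) m z hs).1.const_mul _
  · refine Summable.of_nonneg_of_le (fun n => integral_nonneg fun t => norm_nonneg _) (fun n => ?_)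
      (hsum.norm.mul_left (m.factorial : ℝ))
    simp_rw [norm_mul (b n), integral_const_mul]
    by_cases hn : b n = 0
    · simp [hn]
    · rw [mul_left_comm]
      exact mul_le_mul_of_nonneg_left (vertical_term (hb n hn) m z hs).2.2 (norm_nonneg _)

/-- The parts with `n > 0` and `n < 0` obey the same integration formula, and `primCoef` ignores `n
= 0`, so the two halves add up to a single series. -/
lemma vPrime_eq {k : ℕ} {f : ℍ → ℂ} (hf : QSummable (fourierCoef f)) (z : ℍ) :
    vPrime k f z = (-1) ^ (k - 2 + 1) * (k - 2).factorial *
      qSeries (primCoef (fourierCoef f) (k - 2 + 1)) z := by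
  set a := fourierCoef f
  set b : ℤ → ℂ := fun n => if 0 < n then a n else 0 with hb
  set c : ℤ → ℂ := fun n => if n < 0 then a n else 0 with hc
  have hbs : QSummable b := hf.of_norm_le fun n => by
    rw [hb]
    dsimp only
    split_ifs <;> simp
  have hcs : QSummable c := hf.of_norm_le fun n => by
    rw [hc]
    dsimp only
    split_ifs <;> simp
  have h1 := vertical_integral (b := b) (s := 1) (by norm_num) (fun n hn => by
    have : 0 < n := by
      by_contra h
      exact hn (if_neg h)
    rw [mul_one]
    exact_mod_cast this) (k - 2) (hbs z)
  have h2 := vertical_integral (b := c) (s := -1) (by norm_num) (fun n hn => by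
    have : n < 0 := by
      by_contra h
      exact hn (if_neg h)
    have : (n : ℝ) < 0 := by exact_mod_cast this
    linarith) (k - 2) (hcs z)
  have e1 : integralUp k (decayingPart f) z = _ := Eq.trans (by
    simp only [integralUp, decayingPart, hb, ite_mul, zero_mul]
    simp [a]) h1
  have e2 : integralDown k (principalPart f) z = _ := Eq.trans (by
    simp only [integralDown, principalPart, hc, ite_mul, zero_mul]
    simp [a, sub_eq_add_neg]) h2
  have e3 : primCoef a (k - 2 + 1) = primCoef b (k - 2 + 1) + primCoef c (k - 2 + 1) := by
    rw [← primCoef_add]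
    ext n
    simp only [primCoef, hb, hc, Pi.add_apply]
    split_ifs <;> first | omega | simp
  rw [vPrime, e1, e2, e3, qSeries_add (hbs.primCoef _) (hcs.primCoef _) z.im_pos, mul_add]

/-! ### The parabolic cochain of a cusp form -/

/-- `γ ↦ d⁰ v'_f (γ)` for `f = ∑ aₙ qⁿ` with `a₀ = 0`. -/
def cuspCochain (a : ℤ → ℂ) (m : ℕ) : SL(2, ℤ) → PolyLE ℂ m :=
  eichlerCochain a m - dZero ℂ m (kernelPoly a m Complex.I)

/-- For `a₀ = 0` the function `v'_f` is minus the diagonal of the kernel, hence differs from the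
function whose coboundary is `φ(f)` by the polynomial `K(i, ·)`. -/
lemma isCuspCocycle_cuspCochain {k : ℕ} (hk : 2 ≤ k) {f : ℍ → ℂ} (hf : IsWeaklyHolomorphic k f)
    (h0 : fourierCoef f 0 = 0) : IsCuspCocycle k f (cuspCochain (fourierCoef f) (k - 2)) := by
  intro γ z
  have hv : ∀ z : ℍ, vPrime k f z = -eichlerKernel (fourierCoef f) (k - 2) z z := by
    intro z
    rw [vPrime_eq hf.qSummable, eichlerKernel_self, iterPrim, h0]
    ring
  rw [cuspCochain, Pi.sub_apply, map_sub, Polynomial.eval_sub, dZero_eval,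
    eichlerCochain_eval_eq_dZeroFun hk hf]
  simp only [dZeroFun, hv, kernelPoly_eval]
  ring

lemma cuspCochain_mem_parCocycles {k : ℕ} (hk : 2 ≤ k) {f : ℍ → ℂ} (hf : IsWeaklyHolomorphic k f)
    (h0 : fourierCoef f 0 = 0) :
    cuspCochain (fourierCoef f) (k - 2) ∈ parCocycles ℂ (k - 2) := by
  have h := isCuspCocycle_cuspCochain hk hf h0
  refine ⟨mem_cocycles_of_dZeroFun _ h, mem_vanishAtT_of_dZeroFun _ h fun z => ?_⟩
  -- As a series in `q`, `v'_f` is invariant under `z ↦ z + 1`.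
  rw [vPrime_eq hf.qSummable, vPrime_eq hf.qSummable, UpperHalfPlane.modular_T_smul]
  simp [add_comm (1 : ℂ), qSeries_add_one]

lemma cuspCochain_add {a b : ℤ → ℂ} (ha : QSummable a) (hb : QSummable b) (m : ℕ) :
    cuspCochain (a + b) m = cuspCochain a m + cuspCochain b m := by
  rw [cuspCochain, eichlerCochain_add ha hb, kernelPoly_add ha hb m (by simp), map_add,
    cuspCochain, cuspCochain]
  abel

lemma cuspCochain_smul (c : ℂ) (a : ℤ → ℂ) (m : ℕ) :
    cuspCochain (c • a) m = c • cuspCochain a m := by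
  rw [cuspCochain, eichlerCochain_smul, kernelPoly_smul, map_smul, cuspCochain, smul_sub]

/-! ### Comparison of rational and complex cohomology -/

open Polynomial in
-- The integers `c j` are read off in `ℤ[X]` and so serve all fields at once; this is why additive
-- maps on coefficients commute with the action.
lemma slashRaw_coeff (m : ℕ) (γ : SL(2, ℤ)) (i : ℕ) :
    ∃ c : ℕ → ℤ, ∀ (L : Type) [Field L] (p : L[X]),
      (slashRaw m γ p).coeff i = ∑ j ∈ Finset.range (m + 1), (c j : L) * p.coeff j := by
  refine ⟨fun j => (((C (γ 0 0) * X + C (γ 0 1)) ^ j *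
    (C (γ 1 0) * X + C (γ 1 1)) ^ (m - j) : ℤ[X])).coeff i, fun L _ p => ?_⟩
  rw [slashRaw, finsetSum_coeff]
  refine Finset.sum_congr rfl fun j _ => ?_
  rw [coeff_C_mul, mul_comm]
  congr 1
  have h := coeff_map (Int.castRingHom L) i (p := ((C (γ 0 0) * X + C (γ 0 1)) ^ j *
    (C (γ 1 0) * X + C (γ 1 1)) ^ (m - j) : ℤ[X]))
  simpa using h

section Comparison

variable {K : Type} [Field K] [Algebra K ℂ] {m : ℕ}

lemma polySlash_one (p : PolyLE ℂ m) : polySlash ℂ m 1 p = p :=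
  PolyLE.ext_eval fun z => by
    rw [polySlash_eval_coe]
    simp

open Polynomial in
/-- The map on polynomials obtained by applying a `K`-linear functional `ℂ → K` to the
coefficients. -/
def polyCoord (ℓ : ℂ →ₗ[K] K) : PolyLE ℂ m →ₗ[K] PolyLE K m where
  toFun p := .ofPoly (∑ i ∈ Finset.range (m + 1), C (ℓ (p.toPoly.coeff i)) * X ^ i) <| by
    refine degree_le_of_natDegree_le (natDegree_sum_le_of_forall_le _ _ fun i hi => ?_)
    exact (natDegree_C_mul_X_pow_le _ _).trans (Nat.lt_succ_iff.mp (Finset.mem_range.mp hi))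
  map_add' p q := by
    apply PolyLE.toPoly_injective
    simp [PolyLE.toPoly_ofPoly, add_mul, Finset.sum_add_distrib]
  map_smul' c p := by
    apply PolyLE.toPoly_injective
    simp [PolyLE.toPoly_ofPoly, Finset.smul_sum, smul_eq_C_mul, mul_assoc]

lemma PolyLE.coeff_eq_zero {K : Type} [Field K] {m : ℕ} (p : PolyLE K m) {i : ℕ} (hi : m < i) :
    p.toPoly.coeff i = 0 :=
  Polynomial.coeff_eq_zero_of_degree_lt (p.degree_le.trans_lt (by exact_mod_cast hi))

lemma polyCoord_coeff (ℓ : ℂ →ₗ[K] K) (p : PolyLE ℂ m) (i : ℕ) :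
    (polyCoord ℓ p).toPoly.coeff i = ℓ (p.toPoly.coeff i) := by
  rcases le_or_gt i m with hi | hi
  · change (Polynomial.coeff (∑ j ∈ Finset.range (m + 1), _) i) = _
    simp [Polynomial.finsetSum_coeff, Polynomial.coeff_C_mul, Polynomial.coeff_X_pow,
      Nat.lt_succ_of_le hi]
  · rw [PolyLE.coeff_eq_zero _ hi, PolyLE.coeff_eq_zero _ hi, map_zero]

lemma polyCoord_slash (ℓ : ℂ →ₗ[K] K) (γ : SL(2, ℤ)) (p : PolyLE ℂ m) :
    polyCoord ℓ (polySlash ℂ m γ p) = polySlash K m γ (polyCoord ℓ p) := by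
  apply PolyLE.toPoly_injective
  ext i
  obtain ⟨c, hc⟩ := slashRaw_coeff m γ i
  rw [polyCoord_coeff, polySlash_toPoly, polySlash_toPoly, hc ℂ, hc K, map_sum]
  refine Finset.sum_congr rfl fun j _ => ?_
  rw [polyCoord_coeff, ← zsmul_eq_mul, ← zsmul_eq_mul, map_zsmul]

/-- The map on cochains obtained by applying a `K`-linear functional to the coefficients. -/
def cochainCoord (ℓ : ℂ →ₗ[K] K) : (SL(2, ℤ) → PolyLE ℂ m) →ₗ[K] (SL(2, ℤ) → PolyLE K m) :=
  LinearMap.pi fun γ => polyCoord ℓ ∘ₗ LinearMap.proj γ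

lemma cochainCoord_apply (ℓ : ℂ →ₗ[K] K) (σ : SL(2, ℤ) → PolyLE ℂ m) (γ : SL(2, ℤ)) :
    cochainCoord ℓ σ γ = polyCoord ℓ (σ γ) := rfl

lemma cochainCoord_mem_cocycles (ℓ : ℂ →ₗ[K] K) {σ : SL(2, ℤ) → PolyLE ℂ m}
    (hσ : σ ∈ cocycles ℂ m) : cochainCoord ℓ σ ∈ cocycles K m := by
  rw [mem_cocycles_iff] at hσ ⊢
  intro g₁ g₂
  simp only [cochainCoord_apply, hσ, map_add, polyCoord_slash]

lemma cochainCoord_mem_coboundaries (ℓ : ℂ →ₗ[K] K) {σ : SL(2, ℤ) → PolyLE ℂ m}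
    (hσ : σ ∈ coboundaries ℂ m) : cochainCoord ℓ σ ∈ coboundaries K m := by
  obtain ⟨p, rfl⟩ := hσ
  refine ⟨polyCoord ℓ p, ?_⟩
  ext1 γ
  simp [dZero, cochainCoord, polyCoord_slash]

lemma cochainCoord_mem_vanishAtT (ℓ : ℂ →ₗ[K] K) {σ : SL(2, ℤ) → PolyLE ℂ m}
    (hσ : σ ∈ vanishAtT ℂ m) : cochainCoord ℓ σ ∈ vanishAtT K m := by
  simp only [vanishAtT, LinearMap.mem_ker, LinearMap.proj_apply] at hσ ⊢
  rw [cochainCoord_apply, hσ, map_zero]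

/-- The polynomials with coefficients in a `K`-subspace of `ℂ`. -/
def polyIn (m : ℕ) (V : Submodule K ℂ) : AddSubgroup (PolyLE ℂ m) where
  carrier := {p | ∀ i, p.toPoly.coeff i ∈ V}
  zero_mem' i := by simp
  add_mem' hp hq i := by
    rw [map_add, Polynomial.coeff_add]
    exact add_mem (hp i) (hq i)
  neg_mem' hp i := by
    rw [map_neg, Polynomial.coeff_neg]
    exact neg_mem (hp i)

lemma polySlash_mem_polyIn {V : Submodule K ℂ} {p : PolyLE ℂ m} (hp : p ∈ polyIn m V)
    (γ : SL(2, ℤ)) : polySlash ℂ m γ p ∈ polyIn m V := by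
  intro i
  obtain ⟨c, hc⟩ := slashRaw_coeff m γ i
  rw [polySlash_toPoly, hc ℂ]
  refine sum_mem fun j _ => ?_
  rw [← zsmul_eq_mul]
  exact zsmul_mem (hp j) _

/-- The cocycle relation determines `σ` from its values at the generators, and integrality keeps
coefficients in `V` under the action. -/
lemma cocycle_mem_polyIn {V : Submodule K ℂ} {σ : SL(2, ℤ) → PolyLE ℂ m} (hσ : σ ∈ cocycles ℂ m)
    (hS : σ ModularGroup.S ∈ polyIn m V) (hT : σ ModularGroup.T ∈ polyIn m V) (γ : SL(2, ℤ)) :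
    σ γ ∈ polyIn m V := by
  rw [mem_cocycles_iff] at hσ
  have h1 : σ 1 = 0 := by
    have h := hσ 1 1
    rw [mul_one, polySlash_one] at h
    exact left_eq_add.mp h
  have hγ : γ ∈ Subgroup.closure {ModularGroup.S, ModularGroup.T} := by
    simp [SpecialLinearGroup.SL2Z_generators]
  induction hγ using Subgroup.closure_induction with
  | mem x hx =>
    rcases hx with rfl | rfl
    · exact hS
    · exact hT
  | one => rw [h1]; exact zero_mem _
  | mul x y _ _ hx hy => rw [hσ]; exact add_mem (polySlash_mem_polyIn hx y) hy
  | inv x _ hx =>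
    have h := hσ x⁻¹ x
    rw [mul_inv_cancel, h1, eq_comm, add_comm] at h
    rw [eq_neg_of_add_eq_zero_left h]
    exact neg_mem (polySlash_mem_polyIn hx _)

/-- A complex cocycle is a finite linear combination of the cocycles of its coordinates with respect
to a `K`-basis of `ℂ`. -/
lemma exists_eq_sum_cochainExt {ι : Type} (b : Module.Basis ι K ℂ) {σ : SL(2, ℤ) → PolyLE ℂ m}
    (hσ : σ ∈ cocycles ℂ m) :
    ∃ s : Finset ι, σ = ∑ i ∈ s, b i • cochainExt K m (cochainCoord (b.coord i) σ) := by
  classical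
  -- The basis vectors occurring in the coefficients of `σ(S)` and `σ(T)`; they suffice for every
  -- `σ(γ)`.
  set s : Finset ι := (Finset.range (m + 1)).biUnion fun j =>
    (b.repr ((σ ModularGroup.S).toPoly.coeff j)).support ∪
      (b.repr ((σ ModularGroup.T).toPoly.coeff j)).support with hs
  set V : Submodule K ℂ := Submodule.span K (b '' s) with hV
  have hmem : ∀ x : ℂ, (b.repr x).support ⊆ s → x ∈ V := fun x hx =>
    b.mem_span_image.mpr (by exact_mod_cast hx)
  have hgen : ∀ p : PolyLE ℂ m,
      (∀ j ∈ Finset.range (m + 1), (b.repr (p.toPoly.coeff j)).support ⊆ s) → p ∈ polyIn m V := by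
    intro p hp i
    rcases le_or_gt i m with hi | hi
    · exact hmem _ (hp i (Finset.mem_range.mpr (Nat.lt_succ_of_le hi)))
    · rw [PolyLE.coeff_eq_zero _ hi]
      exact zero_mem _
  have hS : σ ModularGroup.S ∈ polyIn m V := hgen _ fun j hj =>
    Finset.subset_union_left.trans (Finset.subset_biUnion_of_mem (fun j =>
      (b.repr ((σ ModularGroup.S).toPoly.coeff j)).support ∪
        (b.repr ((σ ModularGroup.T).toPoly.coeff j)).support) hj)
  have hT : σ ModularGroup.T ∈ polyIn m V := hgen _ fun j hj =>
    Finset.subset_union_right.trans (Finset.subset_biUnion_of_mem (fun j =>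
      (b.repr ((σ ModularGroup.S).toPoly.coeff j)).support ∪
        (b.repr ((σ ModularGroup.T).toPoly.coeff j)).support) hj)
  refine ⟨s, ?_⟩
  ext1 γ
  apply PolyLE.toPoly_injective
  ext i
  have hx := cocycle_mem_polyIn hσ hS hT γ i
  rw [Finset.sum_apply, map_sum, Polynomial.finsetSum_coeff]
  have hsub : (b.repr ((σ γ).toPoly.coeff i)).support ⊆ s := by
    exact_mod_cast b.mem_span_image.mp hx
  conv_lhs => rw [← b.linearCombination_repr ((σ γ).toPoly.coeff i)]
  rw [Finsupp.linearCombination_apply, Finsupp.sum_of_support_subset _ hsub _ (by simp)]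
  refine Finset.sum_congr rfl fun j _ => ?_
  rw [Pi.smul_apply, map_smul, Polynomial.coeff_smul, smul_eq_mul]
  change _ = b j * ((polyExt K m (polyCoord (b.coord j) (σ γ))).toPoly.coeff i)
  rw [polyExt_toPoly, Polynomial.coeff_map, polyCoord_coeff, Algebra.smul_def, mul_comm,
    Module.Basis.coord_apply]

/-- Coordinates are dual to the basis, so the components of such a sum are recovered; injectivity of
the comparison maps rests on this. -/
lemma cochainCoord_sum_smul_cochainExt {ι : Type} (b : Module.Basis ι K ℂ) (s : Finset ι)
    (τ : ι → SL(2, ℤ) → PolyLE K m) {i : ι} (hi : i ∈ s) :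
    cochainCoord (b.coord i) (∑ j ∈ s, b j • cochainExt K m (τ j)) = τ i := by
  classical
  ext1 γ
  apply PolyLE.toPoly_injective
  ext n
  rw [cochainCoord_apply, polyCoord_coeff, Finset.sum_apply, map_sum, Polynomial.finsetSum_coeff,
    map_sum]
  have h : ∀ j ∈ s, b.coord i (((b j • cochainExt K m (τ j)) γ).toPoly.coeff n) =
      if j = i then (τ i γ).toPoly.coeff n else 0 := by
    intro j _
    rw [Pi.smul_apply, map_smul, Polynomial.coeff_smul, smul_eq_mul]
    change b.coord i (b j * ((polyExt K m (τ j γ)).toPoly.coeff n)) = _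
    rw [polyExt_toPoly, Polynomial.coeff_map, mul_comm, ← Algebra.smul_def, map_smul,
      Module.Basis.coord_apply, b.repr_self, Finsupp.single_apply]
    split_ifs with hj <;> simp [hj]
  rw [Finset.sum_congr rfl h, Finset.sum_ite_eq', if_pos hi]

lemma compareH_tmul (c : ℂ) (σ : cocycles K m) :
    compareH K m (c ⊗ₜ cocycleClass K m σ) = c • cocycleClass ℂ m (cocycleExt K m σ) := rfl

lemma compareHPar_tmul (c : ℂ) (σ : parCocycles K m) :
    compareHPar K m (c ⊗ₜ parCocycleClass K m σ) =
      c • parCocycleClass ℂ m (parCocycleExt K m σ) := rfl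

/-- Every element of `ℂ ⊗ (Z / B)` is a finite sum `∑ bᵢ ⊗ [τᵢ]` for a `K`-basis `b` of `ℂ`. -/
lemma exists_eq_sum_tmul_mk {ι M : Type} [AddCommGroup M] [Module K M] (b : Module.Basis ι K ℂ)
    (Z : Submodule K M) (B : Submodule K Z) (x : ℂ ⊗[K] (Z ⧸ B)) :
    ∃ τ : ι →₀ Z, x = τ.sum fun i t => b i ⊗ₜ (Submodule.Quotient.mk t : Z ⧸ B) := by
  classical
  induction x using TensorProduct.induction_on with
  | zero => exact ⟨0, by simp⟩
  | tmul c y =>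
    obtain ⟨y, rfl⟩ := Submodule.Quotient.mk_surjective _ y
    refine ⟨(b.repr c).mapRange (fun r => r • y) (zero_smul K y), ?_⟩
    rw [Finsupp.sum_mapRange_index (by simp)]
    conv_lhs => rw [← b.linearCombination_repr c, Finsupp.linearCombination_apply,
      Finsupp.sum, TensorProduct.sum_tmul]
    exact Finset.sum_congr rfl fun i _ => by
      rw [TensorProduct.smul_tmul]; rfl
  | add x y hx hy =>
    obtain ⟨τ, rfl⟩ := hx
    obtain ⟨τ', rfl⟩ := hy
    refine ⟨τ + τ', ?_⟩
    rw [Finsupp.sum_add_index' (by simp) fun i t t' => by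
      rw [Submodule.Quotient.mk_add, TensorProduct.tmul_add]]

/-- A natural map `ℂ ⊗ (Z_K / B_K) → Z_ℂ / B_ℂ` is bijective if taking coordinates of cochains with
respect to a `K`-basis of `ℂ` preserves cocycles and coboundaries. -/
lemma bijective_of_coord {ZK BK : Submodule K (SL(2, ℤ) → PolyLE K m)}
    {ZC BC : Submodule ℂ (SL(2, ℤ) → PolyLE ℂ m)} (hle : ZC ≤ cocycles ℂ m)
    (hZ : ∀ (ℓ : ℂ →ₗ[K] K), ∀ σ ∈ ZC, cochainCoord ℓ σ ∈ ZK)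
    (hB : ∀ (ℓ : ℂ →ₗ[K] K), ∀ σ ∈ BC, cochainCoord ℓ σ ∈ BK)
    (e : ZK →ₗ[K] ZC) (he : ∀ τ : ZK, (e τ : SL(2, ℤ) → PolyLE ℂ m) = cochainExt K m τ)
    (F : ℂ ⊗[K] (ZK ⧸ BK.submoduleOf ZK) →ₗ[ℂ] (ZC ⧸ BC.submoduleOf ZC))
    (hF : ∀ (c : ℂ) (τ : ZK), F (c ⊗ₜ Submodule.Quotient.mk τ) =
      c • Submodule.Quotient.mk (e τ)) : Function.Bijective F := by
  let b := Module.Basis.ofVectorSpace K ℂ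
  have hsum : ∀ (s : Finset _) (τ : _ → ZK),
      F (∑ i ∈ s, b i ⊗ₜ Submodule.Quotient.mk (τ i)) =
        Submodule.Quotient.mk (∑ i ∈ s, b i • e (τ i)) := by
    intro s τ
    rw [map_sum, ← Submodule.mkQ_apply, map_sum]
    exact Finset.sum_congr rfl fun i _ => hF _ _
  have hcoe : ∀ (s : Finset _) (τ : _ → ZK),
      ((∑ i ∈ s, b i • e (τ i) : ZC) : SL(2, ℤ) → PolyLE ℂ m) =
        ∑ i ∈ s, b i • cochainExt K m (τ i) := by
    intro s τ
    rw [Submodule.coe_sum]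
    exact Finset.sum_congr rfl fun i _ => by rw [Submodule.coe_smul, he]
  constructor
  · rw [injective_iff_map_eq_zero]
    intro x hx
    obtain ⟨τ, rfl⟩ := exists_eq_sum_tmul_mk b _ _ x
    rw [Finsupp.sum, hsum, Submodule.Quotient.mk_eq_zero, Submodule.submoduleOf,
      Submodule.mem_comap, Submodule.coe_subtype, hcoe] at hx
    refine Finset.sum_eq_zero fun i hi => ?_
    -- The `i`-th coordinate of the complex coboundary is a coboundary over `K`, and it equals `τ
    -- i`.
    have h := hB (b.coord i) _ hx
    rw [cochainCoord_sum_smul_cochainExt b τ.support (fun j => (τ j).1) hi] at h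
    dsimp only
    rw [(Submodule.Quotient.mk_eq_zero _).mpr (show _ ∈ BK.submoduleOf ZK from h),
      TensorProduct.tmul_zero]
  · intro y
    obtain ⟨σ, rfl⟩ := Submodule.Quotient.mk_surjective _ y
    obtain ⟨s, hs⟩ := exists_eq_sum_cochainExt b (hle σ.2)
    refine ⟨∑ i ∈ s, b i ⊗ₜ Submodule.Quotient.mk ⟨_, hZ (b.coord i) _ σ.2⟩, ?_⟩
    rw [hsum]
    congr 1
    exact Subtype.ext ((hcoe _ _).trans hs.symm)

lemma compareH_bijective : Function.Bijective (compareH K m) :=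
  bijective_of_coord le_rfl (fun ℓ _ => cochainCoord_mem_cocycles ℓ)
    (fun ℓ _ => cochainCoord_mem_coboundaries ℓ) (cocycleExt K m) (fun _ => rfl) _ compareH_tmul

lemma compareHPar_bijective : Function.Bijective (compareHPar K m) :=
  bijective_of_coord (ZK := parCocycles K m) (BK := parCoboundaries K m) (ZC := parCocycles ℂ m)
    (BC := parCoboundaries ℂ m) (parCocycles_le ℂ m)
    (fun ℓ _ h => ⟨cochainCoord_mem_cocycles ℓ h.1, cochainCoord_mem_vanishAtT ℓ h.2⟩)
    (fun ℓ _ h => ⟨cochainCoord_mem_coboundaries ℓ h.1, cochainCoord_mem_vanishAtT ℓ h.2⟩)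
    (parCocycleExt K m) (fun _ => rfl) _ compareHPar_tmul

end Comparison

/-! ### The maps on classes -/

lemma IsWeaklyHolomorphic.fourierCoef_add {w : ℤ} {f g : ℍ → ℂ} (hf : IsWeaklyHolomorphic w f)
    (hg : IsWeaklyHolomorphic w g) : fourierCoef (f + g) = fourierCoef f + fourierCoef g :=
  funext fun n => _root_.fourierCoef_add hf.mdiff hg.mdiff n

lemma fourierCoef_smul_eq (c : ℂ) (f : ℍ → ℂ) : fourierCoef (c • f) = c • fourierCoef f :=
  funext fun n => fourierCoef_smul c f n

/-- The commutativity of the square in (a) reduces to this. -/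
lemma cuspCochain_sub_eichlerCochain_mem_coboundaries (a : ℤ → ℂ) (m : ℕ) :
    cuspCochain a m - eichlerCochain a m ∈ coboundaries ℂ m := by
  rw [cuspCochain, sub_sub_cancel_left]
  exact neg_mem ⟨_, rfl⟩

/-- The map `f ↦ φ(f)` from `M_k^!` to cocycles. -/
def eichlerMap {k : ℕ} (hk : 2 ≤ k) : weakForms ℂ k →ₗ[ℂ] cocycles ℂ (k - 2) where
  toFun f := ⟨eichlerCochain (fourierCoef f) (k - 2), eichlerCochain_mem_cocycles hk f.2.1⟩
  map_add' f g := Subtype.ext <| by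
    dsimp only [Submodule.coe_add]
    rw [f.2.1.fourierCoef_add g.2.1, eichlerCochain_add f.2.1.qSummable g.2.1.qSummable]
  map_smul' c f := Subtype.ext <| by
    dsimp only [Submodule.coe_smul, RingHom.id_apply]
    rw [fourierCoef_smul_eq, eichlerCochain_smul]

/-- The map `f ↦ φ'(f)` from `S_k^!` to parabolic cocycles. -/
def cuspMap {k : ℕ} (hk : 2 ≤ k) : weakCuspForms ℂ k →ₗ[ℂ] parCocycles ℂ (k - 2) where
  toFun f := ⟨cuspCochain (fourierCoef f) (k - 2), cuspCochain_mem_parCocycles hk f.2.1.1 f.2.2⟩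
  map_add' f g := Subtype.ext <| by
    dsimp only [Submodule.coe_add]
    rw [f.2.1.1.fourierCoef_add g.2.1.1, cuspCochain_add f.2.1.1.qSummable g.2.1.1.qSummable]
  map_smul' c f := Subtype.ext <| by
    dsimp only [Submodule.coe_smul, RingHom.id_apply]
    rw [fourierCoef_smul_eq, cuspCochain_smul]

lemma eichlerCochain_mem_coboundaries {k : ℕ} (hk : 2 ≤ k) {f : ℍ → ℂ} (hf : f ∈ exactForms ℂ k) :
    eichlerCochain (fourierCoef f) (k - 2) ∈ coboundaries ℂ (k - 2) := by
  obtain ⟨g, hg, rfl⟩ := hf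
  exact eichlerCochain_iterD_mem_coboundaries hk hg.1

lemma cuspCochain_mem_coboundaries {k : ℕ} (hk : 2 ≤ k) {f : ℍ → ℂ} (hf : f ∈ exactForms ℂ k) :
    cuspCochain (fourierCoef f) (k - 2) ∈ coboundaries ℂ (k - 2) := by
  rw [← sub_add_cancel (cuspCochain _ _) (eichlerCochain (fourierCoef f) (k - 2))]
  exact add_mem (cuspCochain_sub_eichlerCochain_mem_coboundaries _ _)
    (eichlerCochain_mem_coboundaries hk hf)

/-- The map `[φ]` on classes. -/
def eichlerClassMap {k : ℕ} (hk : 2 ≤ k) : FormClasses ℂ k →ₗ[ℂ] HOne ℂ (k - 2) :=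
  Submodule.mapQ _ _ (eichlerMap hk) fun _ hf => eichlerCochain_mem_coboundaries hk hf

/-- The map `[φ']` on classes. -/
def cuspClassMap {k : ℕ} (hk : 2 ≤ k) : CuspFormClasses ℂ k →ₗ[ℂ] HOnePar ℂ (k - 2) :=
  Submodule.mapQ _ _ (cuspMap hk) fun f hf =>
    ⟨cuspCochain_mem_coboundaries hk hf, (cuspMap hk f).2.2⟩

lemma natJ_comp_cuspClassMap {k : ℕ} (hk : 2 ≤ k) :
    natJ ℂ (k - 2) ∘ₗ cuspClassMap hk = eichlerClassMap hk ∘ₗ natI ℂ k :=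
  Submodule.linearMap_qext _ <| LinearMap.ext fun _ => (Submodule.Quotient.eq _).mpr <|
    cuspCochain_sub_eichlerCochain_mem_coboundaries _ _

/-! ### Injectivity of the natural maps -/

lemma natI_injective (K : Type) [Field K] [Algebra K ℂ] (k : ℕ) :
    Function.Injective (natI K k) := by
  rw [injective_iff_map_eq_zero]
  intro x hx
  obtain ⟨f, rfl⟩ := Submodule.Quotient.mk_surjective _ x
  have h : Submodule.inclusion (weakCuspForms_le K k) f ∈
    (exactForms K k).submoduleOf (weakForms K k) := (Submodule.Quotient.mk_eq_zero _).mp hx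
  exact (Submodule.Quotient.mk_eq_zero _).mpr h

/-- A parabolic cocycle that is a coboundary already vanishes at `T`, which is all that a parabolic
coboundary requires. -/
lemma natJ_injective (K : Type) [Field K] (m : ℕ) : Function.Injective (natJ K m) := by
  rw [injective_iff_map_eq_zero]
  intro x hx
  obtain ⟨σ, rfl⟩ := Submodule.Quotient.mk_surjective _ x
  have h : Submodule.inclusion (parCocycles_le K m) σ ∈
    (coboundaries K m).submoduleOf (cocycles K m) := (Submodule.Quotient.mk_eq_zero _).mp hx
  exact (Submodule.Quotient.mk_eq_zero _).mpr ⟨h, σ.2.2⟩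

/-! ### Transport of the class maps to coefficients in a subfield -/

section Rational

variable (K : Type) [Field K] [Algebra K ℂ] (k : ℕ)

lemma mem_weakForms_complex {w : ℤ} {f : ℍ → ℂ} (hf : f ∈ weakForms K w) : f ∈ weakForms ℂ w :=
  ⟨hf.1, fun _ => ⟨_, rfl⟩⟩

lemma mem_weakCuspForms_complex {w : ℤ} {f : ℍ → ℂ} (hf : f ∈ weakCuspForms K w) :
    f ∈ weakCuspForms ℂ w := ⟨mem_weakForms_complex K hf.1, hf.2⟩

lemma mem_exactForms_complex {f : ℍ → ℂ} (hf : f ∈ exactForms K k) : f ∈ exactForms ℂ k := by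
  obtain ⟨g, hg, rfl⟩ := hf
  exact ⟨g, mem_weakForms_complex K hg, rfl⟩

/-- The inclusion of the forms with Fourier coefficients in `K`. -/
def formExt : weakForms K k →ₗ[K] weakForms ℂ k where
  toFun f := ⟨f.1, mem_weakForms_complex K f.2⟩
  map_add' _ _ := rfl
  map_smul' _ _ := rfl

/-- The inclusion of the cusp forms with Fourier coefficients in `K`. -/
def cuspFormExt : weakCuspForms K k →ₗ[K] weakCuspForms ℂ k where
  toFun f := ⟨f.1, mem_weakCuspForms_complex K f.2⟩
  map_add' _ _ := rfl
  map_smul' _ _ := rfl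

/-- The natural map `ℂ ⊗ (M_{k,K}^! / D^{k-1} M_{2-k,K}^!) → M_k^! / D^{k-1} M_{2-k}^!`. -/
def compareForms : ℂ ⊗[K] FormClasses K k →ₗ[ℂ] FormClasses ℂ k :=
  LinearMap.liftBaseChange ℂ <|
    Submodule.liftQ _
      (((Submodule.mkQ ((exactForms ℂ k).submoduleOf (weakForms ℂ k))).restrictScalars K) ∘ₗ
        formExt K k)
      (fun _ hf => (Submodule.Quotient.mk_eq_zero _).mpr (mem_exactForms_complex K k hf))

/-- The natural map `ℂ ⊗ (S_{k,K}^! / D^{k-1} M_{2-k,K}^!) → S_k^! / D^{k-1} M_{2-k}^!`. -/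
def compareCuspForms : ℂ ⊗[K] CuspFormClasses K k →ₗ[ℂ] CuspFormClasses ℂ k :=
  LinearMap.liftBaseChange ℂ <|
    Submodule.liftQ _
      (((Submodule.mkQ ((exactForms ℂ k).submoduleOf (weakCuspForms ℂ k))).restrictScalars K) ∘ₗ
        cuspFormExt K k)
      (fun _ hf => (Submodule.Quotient.mk_eq_zero _).mpr (mem_exactForms_complex K k hf))

lemma compareForms_one_tmul (f : weakForms K k) :
    compareForms K k (1 ⊗ₜ formClass K k f) = formClass ℂ k (formExt K k f) :=
  one_smul ℂ (formClass ℂ k (formExt K k f))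

lemma compareCuspForms_one_tmul (f : weakCuspForms K k) :
    compareCuspForms K k (1 ⊗ₜ cuspFormClass K k f) = cuspFormClass ℂ k (cuspFormExt K k f) :=
  one_smul ℂ (cuspFormClass ℂ k (cuspFormExt K k f))

lemma natI_compareCuspForms (x : ℂ ⊗[K] CuspFormClasses K k) :
    natI ℂ k (compareCuspForms K k x) = compareForms K k ((natI K k).baseChange ℂ x) := by
  induction x using TensorProduct.induction_on with
  | zero => simp only [map_zero]
  | tmul c y =>
    obtain ⟨f, rfl⟩ := Submodule.Quotient.mk_surjective _ y
    rfl
  | add x y hx hy => simp only [map_add, hx, hy]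

lemma natJ_compareHPar (m : ℕ) (x : ℂ ⊗[K] HOnePar K m) :
    natJ ℂ m (compareHPar K m x) = compareH K m ((natJ K m).baseChange ℂ x) := by
  induction x using TensorProduct.induction_on with
  | zero => simp only [map_zero]
  | tmul c y =>
    obtain ⟨f, rfl⟩ := Submodule.Quotient.mk_surjective _ y
    rfl
  | add x y hx hy => simp only [map_add, hx, hy]

variable {k}

/-- The map `[φ]` in terms of classes with coefficients in `K`. -/
def eichlerClassMapOver (hk : 2 ≤ k) :
    ℂ ⊗[K] FormClasses K k →ₗ[ℂ] ℂ ⊗[K] HOne K (k - 2) :=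
  (LinearEquiv.ofBijective (compareH K (k - 2)) compareH_bijective).symm.toLinearMap ∘ₗ
    eichlerClassMap hk ∘ₗ compareForms K k

/-- The map `[φ']` in terms of classes with coefficients in `K`. -/
def cuspClassMapOver (hk : 2 ≤ k) :
    ℂ ⊗[K] CuspFormClasses K k →ₗ[ℂ] ℂ ⊗[K] HOnePar K (k - 2) :=
  (LinearEquiv.ofBijective (compareHPar K (k - 2)) compareHPar_bijective).symm.toLinearMap ∘ₗ
    cuspClassMap hk ∘ₗ compareCuspForms K k

lemma compareH_eichlerClassMapOver (hk : 2 ≤ k) (x : ℂ ⊗[K] FormClasses K k) :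
    compareH K (k - 2) (eichlerClassMapOver K hk x) = eichlerClassMap hk (compareForms K k x) :=
  (LinearEquiv.ofBijective (compareH K (k - 2)) compareH_bijective).apply_symm_apply _

lemma compareHPar_cuspClassMapOver (hk : 2 ≤ k) (x : ℂ ⊗[K] CuspFormClasses K k) :
    compareHPar K (k - 2) (cuspClassMapOver K hk x) = cuspClassMap hk (compareCuspForms K k x) :=
  (LinearEquiv.ofBijective (compareHPar K (k - 2)) compareHPar_bijective).apply_symm_apply _

lemma natJ_comp_cuspClassMapOver (hk : 2 ≤ k) :
    (natJ K (k - 2)).baseChange ℂ ∘ₗ cuspClassMapOver K hk =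
      eichlerClassMapOver K hk ∘ₗ (natI K k).baseChange ℂ := by
  -- Injectivity of `compareH` reduces the square over `K` to the complex one, by naturality of the
  -- comparison maps.
  refine LinearMap.ext fun x => compareH_bijective.1 ?_
  rw [LinearMap.comp_apply, LinearMap.comp_apply, ← natJ_compareHPar,
    compareHPar_cuspClassMapOver, compareH_eichlerClassMapOver, ← natI_compareCuspForms]
  exact LinearMap.congr_fun (natJ_comp_cuspClassMap hk) _

end Rational

end

/-! ### The main theorem -/

theorem proposition6p2 (k : ℕ) (hk : 2 ≤ k) :
    -- the quotients make sense: `D^{k-1} M_{2-k}^! ⊆ S_k^!`, over `ℂ` and over `ℚ`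
    (exactForms ℂ k ≤ weakCuspForms ℂ k ∧ exactForms ℚ k ≤ weakCuspForms ℚ k) ∧
    -- complex coefficients
    (∃ (Φ : FormClasses ℂ k →ₗ[ℂ] HOne ℂ (k - 2))
       (Φ' : CuspFormClasses ℂ k →ₗ[ℂ] HOnePar ℂ (k - 2)),
      (∀ f : weakForms ℂ k, ∃ σ : cocycles ℂ (k - 2),
        IsEichlerCocycle k f σ ∧ Φ (formClass ℂ k f) = cocycleClass ℂ (k - 2) σ) ∧
      (∀ f : weakCuspForms ℂ k, ∃ σ : parCocycles ℂ (k - 2),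
        IsCuspCocycle k f σ ∧ Φ' (cuspFormClass ℂ k f) = parCocycleClass ℂ (k - 2) σ) ∧
      Function.Injective (natI ℂ k) ∧ Function.Injective (natJ ℂ (k - 2)) ∧
      natJ ℂ (k - 2) ∘ₗ Φ' = Φ ∘ₗ natI ℂ k) ∧
    -- rational structures, tensored with `ℂ`
    (Function.Bijective (compareH ℚ (k - 2)) ∧ Function.Bijective (compareHPar ℚ (k - 2)) ∧
     ∃ (Φ : ℂ ⊗[ℚ] FormClasses ℚ k →ₗ[ℂ] ℂ ⊗[ℚ] HOne ℚ (k - 2))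
       (Φ' : ℂ ⊗[ℚ] CuspFormClasses ℚ k →ₗ[ℂ] ℂ ⊗[ℚ] HOnePar ℚ (k - 2)),
      (∀ f : weakForms ℚ k, ∃ σ : cocycles ℂ (k - 2), IsEichlerCocycle k f σ ∧
        compareH ℚ (k - 2) (Φ (1 ⊗ₜ formClass ℚ k f)) = cocycleClass ℂ (k - 2) σ) ∧
      (∀ f : weakCuspForms ℚ k, ∃ σ : parCocycles ℂ (k - 2), IsCuspCocycle k f σ ∧
        compareHPar ℚ (k - 2) (Φ' (1 ⊗ₜ cuspFormClass ℚ k f)) = parCocycleClass ℂ (k - 2) σ) ∧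
      Function.Injective ((natI ℚ k).baseChange ℂ) ∧
      Function.Injective ((natJ ℚ (k - 2)).baseChange ℂ) ∧
      (natJ ℚ (k - 2)).baseChange ℂ ∘ₗ Φ' = Φ ∘ₗ (natI ℚ k).baseChange ℂ) := by
  refine ⟨⟨exactForms_le ℂ hk, exactForms_le ℚ hk⟩,
    ⟨eichlerClassMap hk, cuspClassMap hk, fun f => ⟨eichlerMap hk f, f.2.1.isEichlerCocycle, rfl⟩,
      fun f => ⟨cuspMap hk f, isCuspCocycle_cuspCochain hk f.2.1.1 f.2.2, rfl⟩,
      natI_injective ℂ k, natJ_injective ℂ (k - 2), natJ_comp_cuspClassMap hk⟩,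
    compareH_bijective, compareHPar_bijective, eichlerClassMapOver ℚ hk, cuspClassMapOver ℚ hk,
    fun f => ⟨eichlerMap hk (formExt ℚ k f), f.2.1.isEichlerCocycle, ?_⟩,
    fun f => ⟨cuspMap hk (cuspFormExt ℚ k f), isCuspCocycle_cuspCochain hk f.2.1.1 f.2.2, ?_⟩,
    -- `ℂ` is flat over `ℚ`, so the rational injections stay injective after base change.
    Module.Flat.lTensor_preserves_injective_linearMap _ (natI_injective ℚ k),
    Module.Flat.lTensor_preserves_injective_linearMap _ (natJ_injective ℚ (k - 2)),
    natJ_comp_cuspClassMapOver ℚ hk⟩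
  · rw [compareH_eichlerClassMapOver, compareForms_one_tmul]
    rfl
  · rw [compareHPar_cuspClassMapOver, compareCuspForms_one_tmul]
    rfl
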